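/- **Setting.** A path $f:[0,\infty)\to[0,1]$ is a decreasing pure jump path starting from $1$ if $f(0)=1$, $f$ is non-increasing and right-continuous, and $1-f(t)=\sum_{0<s\le t}(f(s-)-f(s))$ for all $t\ge 0$. Let $\alpha>0$ and let $M_n$, $n\ge 1$, be real-valued stochastic processes on a probability space (with an arbitrary joint law) whose paths are almost surely decreasing pure jump paths starting from $1$ with $\int_0^\infty M_n(s)^\alpha\,ds<\infty$. The string of beads of mass $m\ge 0$ associated with $M_n$ and $\alpha$ is the interval $[0,Y]$, $Y=m^\alpha\int_0^\infty M_n(s)^\alpha ds$, with the measure that has an atom of mass $m(M_n(t-)-M_n(t))$ at $m^\alpha\int_0^tM_n(s)^\alpha ds$ for each jump time $t$ of $M_n$. A bead splitting process $((R_n,\mu_n),n\ge1)$ that develops by size-biased branching is the following sequence of random $\mathbb R$-trees with root $0$ and marked end points (leaves) $\Sigma_1,\ldots,\Sigma_n$, equipped with probability measures. $(R_1,\mu_1)$ is the string of beads of mass $1$ associated with $M_1$ and $\alpha$, $R_1=[[0,\Sigma_1]]$. Given $(R_n,\mu_n)$, a point $J_n\in R_n$ is picked with conditional law $\mu_n$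 given $M_1,\dots,M_n,J_1,\dots,J_{n-1}$; with $m=\mu_n(\{J_n\})$, a copy $([[J_n,\Sigma_{n+1}]],\mu_{n,n+1})$ of the string of beads of mass $m$ associated with $M_{n+1}$ and $\alpha$ is attached to $R_n$ at $J_n$ to form $R_{n+1}$, and $\mu_{n+1}=\mu_n-m\delta_{J_n}+\mu_{n,n+1}$. For $n\ge 2$ let $J_{1,n}$ be the point with $[[0,J_{1,n}]]=[[0,\Sigma_1]]\cap[[0,\Sigma_n]]$. The ordered spinal partition is $\Pi^{\rm ord}=(\Pi^{\rm ord}_s)_{s\ge0}$, where $\Pi^{\rm ord}_s$ is the set of all $n\ge2$ such that $J_{1,n}$ is the point of $[[0,\Sigma_1]]$ at distance $s$ from $0$. **Proposition.** (1) For every bead splitting process that develops by size-biased branching, almost surely every $n\in\mathbb N\setminus\{1\}$ lies in $\Pi^{\rm ord}_s$ for exactly one $s$, and $\Pi^{\rm ord}$ is exchangeable: for every permutation $\sigma$ of $\mathbb N\setminus\{1\}$, the point processes of pairs $(s,\Pi^{\rm ord}_s)$ and $(s,\sigma(\Pi^{\rm ord}_s))$, over all $s$ with $\Pi^{\rm ord}_s\neq\emptyset$,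 have the same distribution. (2) Suppose in addition that $M_1$ is a fragmenter, i.e. $M_1(t)=e^{-\xi_t}$ for a subordinator $\xi$ with zero drift and no killing. For each $n$ let $\mathcal C_n$ be the vector of non-zero block sizes $\#(\Pi^{\rm ord}_s\cap\{2,\dots,n+1\})$, arranged by increasing $s$. Then, almost surely, $\mathcal C_n$ is a composition of $n$, i.e. a sequence of positive integers with sum $n$, for every $n$, and $(\mathcal C_n)$ is - strongly sampling consistent: conditionally given $(\mathcal C_{n+1},\mathcal C_{n+2},\dots)$, the composition $\mathcal C_n$ is obtained from $\mathcal C_{n+1}$, viewed as $n+1$ balls in a row of boxes, by removing a ball chosen uniformly at random and deleting its box if it becomes empty; - regenerative: for all $1\le m<n$, conditionally given that the first part of $\mathcal C_n$ is $m$, the sequence of remaining parts is distributed as $\mathcal C_{n-m}$. -/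

import Mathlib

open MeasureTheory ProbabilityTheory Filter Topology
open scoped NNReal ENNReal

namespace BeadSplitting

noncomputable section

/-! ### Strings of beads -/

/-- A decreasing pure jump path `f : [0,∞) → [0,1]` starting from `1`: it is nonnegative,
nonincreasing and right-continuous, and `1 - f t` is the sum of the jumps of `f` up to time `t`. -/
structure IsDecreasingPureJump (f : ℝ≥0 → ℝ) : Prop where
  start : f 0 = 1
  nonneg : ∀ t, 0 ≤ f t
  antitone : Antitone f
  rightCts : ∀ t, ContinuousWithinAt f (Set.Ioi t) t
  pureJump : ∀ t, HasSum (fun s : Set.Iic t => Function.leftLim f s.1 - f s.1) (1 - f t)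

/-- Position `m ^ α * ∫₀ᵗ f(s) ^ α ds` on the string of mass `m` that corresponds to time `t`. -/
def stringPos (f : ℝ≥0 → ℝ) (α m : ℝ) (t : ℝ≥0) : ℝ :=
  m ^ α * ∫ s in (0 : ℝ)..t, f s.toNNReal ^ α

/-- Length `m ^ α * ∫₀^∞ f(s) ^ α ds` of the string of mass `m`. -/
def stringLength (f : ℝ≥0 → ℝ) (α m : ℝ) : ℝ :=
  m ^ α * ∫ s in Set.Ioi (0 : ℝ), f s.toNNReal ^ α

/-- The beads: each jump time `t` of `f` puts mass `m * (f (t-) - f t)` at `stringPos f α m t`.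
(Only countably many summands are nonzero when `f` is monotone.) -/
def stringMeasure (f : ℝ≥0 → ℝ) (α m : ℝ) : Measure ℝ :=
  Measure.sum fun t : ℝ≥0 =>
    ENNReal.ofReal (m * (Function.leftLim f t - f t)) • Measure.dirac (stringPos f α m t)

/-- The measure of a string of beads has the tails `μ (∫₀ᵗ f^α, ∞) = m * f t` (up to scaling of
the positions), so it has total mass `m`. -/
theorem stringMeasure_tail {f : ℝ≥0 → ℝ} (hf : IsDecreasingPureJump f) {α m : ℝ} (hα : 0 < α)
    (hm : 0 < m) (hint : IntegrableOn (fun s : ℝ => f s.toNNReal ^ α) (Set.Ioi 0)) (t : ℝ≥0) :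
    stringMeasure f α m (Set.Ioi (stringPos f α m t)) = ENNReal.ofReal (m * f t) := by
  have hjump : ∀ s, 0 ≤ Function.leftLim f s - f s := fun s =>
    sub_nonneg.2 (hf.antitone.le_leftLim le_rfl)
  have hlim : Tendsto f atTop (𝓝 0) := by
    have hbdd : BddBelow (Set.range f) := ⟨0, by rintro _ ⟨s, rfl⟩; exact hf.nonneg s⟩
    have h1 := tendsto_atTop_ciInf hf.antitone hbdd
    have hl0 : 0 ≤ ⨅ i, f i := le_ciInf hf.nonneg
    rcases hl0.eq_or_lt with h | h
    · rw [h]; exact h1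
    · exfalso
      have hle : ∀ s, (⨅ i, f i) ≤ f s := fun s => ciInf_le hbdd s
      have hpow : 0 < (⨅ i, f i) ^ α := Real.rpow_pos_of_pos h α
      have : IntegrableOn (fun _ : ℝ => (⨅ i, f i) ^ α) (Set.Ioi 0) := by
        refine Integrable.mono hint aestronglyMeasurable_const (ae_of_all _ fun s => ?_)
        rw [Real.norm_of_nonneg hpow.le, Real.norm_of_nonneg (Real.rpow_nonneg (hf.nonneg _) _)]
        exact Real.rpow_le_rpow h.le (hle _) hα.le
      rw [integrableOn_const_iff (by simp)] at this
      have := this.resolve_left (by simpa using hpow.ne')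
      simp at this
  have hII : ∀ a b : ℝ≥0, IntervalIntegrable (fun s : ℝ => f s.toNNReal ^ α) volume a b :=
    fun a b => intervalIntegrable_iff.2 (hint.mono_set (by
      intro x hx
      rw [Set.uIoc, Set.mem_Ioc] at hx
      exact lt_of_le_of_lt (le_min a.2 b.2) hx.1))
  have hmα : 0 < m ^ α := Real.rpow_pos_of_pos hm α
  have hsub : ∀ a b : ℝ≥0, stringPos f α m b - stringPos f α m a =
      m ^ α * ∫ s in (a : ℝ)..b, f s.toNNReal ^ α := fun a b => by
    rw [stringPos, stringPos, ← mul_sub]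
    congr 1
    have := intervalIntegral.integral_add_adjacent_intervals (hII 0 a) (hII a b)
    simp only [NNReal.coe_zero] at this
    linarith
  have hmono : Monotone (stringPos f α m) := fun a b hab => by
    have : 0 ≤ ∫ s in (a : ℝ)..b, f s.toNNReal ^ α :=
      intervalIntegral.integral_nonneg (by exact_mod_cast hab)
        fun s _ => Real.rpow_nonneg (hf.nonneg _) _
    nlinarith [hsub a b, mul_nonneg hmα.le this]
  have hstrict : ∀ s, t < s → 0 < f t → stringPos f α m t < stringPos f α m s := by
    intro s hts hft
    have h1 : ∀ᶠ u in 𝓝[>] t, 0 < f u := (hf.rightCts t).eventually (lt_mem_nhds hft)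
    have h2 : ∀ᶠ u in 𝓝[>] t, u < s := nhdsWithin_le_nhds (Iio_mem_nhds hts)
    have : (𝓝[>] t).NeBot := nhdsGT_neBot_of_exists_gt ⟨s, hts⟩
    obtain ⟨u, ⟨hu0, hus⟩, htu⟩ := ((h1.and h2).and self_mem_nhdsWithin).exists
    have htu : t < u := htu
    refine lt_of_lt_of_le ?_ (hmono hus.le)
    have h3 : ∫ _ in (t : ℝ)..u, f u ^ α ≤ ∫ x in (t : ℝ)..u, f x.toNNReal ^ α :=
      intervalIntegral.integral_mono_on (by exact_mod_cast htu.le) (by simp) (hII t u)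
        fun x hx => Real.rpow_le_rpow hu0.le
          (hf.antitone (Real.toNNReal_le_iff_le_coe.2 hx.2)) hα.le
    rw [intervalIntegral.integral_const, smul_eq_mul] at h3
    have h4 : 0 < ((u : ℝ) - t) * f u ^ α :=
      mul_pos (sub_pos.2 (by exact_mod_cast htu)) (Real.rpow_pos_of_pos hu0 α)
    nlinarith [hsub t u, mul_pos hmα (h4.trans_le h3)]
  have hterm : ∀ s, ENNReal.ofReal (m * (Function.leftLim f s - f s)) *
      Measure.dirac (stringPos f α m s) (Set.Ioi (stringPos f α m t)) =
      ENNReal.ofReal m * (Set.Ioi t).indicator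
        (fun s => ENNReal.ofReal (Function.leftLim f s - f s)) s := by
    intro s
    rw [ENNReal.ofReal_mul hm.le, mul_assoc, Measure.dirac_apply' _ measurableSet_Ioi]
    congr 1
    by_cases hst : t < s
    · rw [Set.indicator_of_mem (show s ∈ Set.Ioi t from hst)]
      rcases (hf.nonneg t).eq_or_lt with h | h
      · have : Function.leftLim f s - f s = 0 :=
          le_antisymm (by linarith [hf.antitone.leftLim_le hst, hf.nonneg s]) (hjump s)
        simp [this]
      · rw [Set.indicator_of_mem (show _ ∈ Set.Ioi _ from hstrict s hst h)]
        simp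
    · rw [Set.indicator_of_notMem (show s ∉ Set.Ioi t from hst),
        Set.indicator_of_notMem (show _ ∉ Set.Ioi _ from (hmono (not_lt.1 hst)).not_gt), mul_zero]
  have hIic : ∀ r, ∑' s : Set.Iic r, ENNReal.ofReal (Function.leftLim f s.1 - f s.1) =
      ENNReal.ofReal (1 - f r) := fun r => by
    have h := ENNReal.ofReal_tsum_of_nonneg
      (f := fun s : Set.Iic r => Function.leftLim f s.1 - f s.1)
      (fun s => hjump s.1) (hf.pureJump r).summable
    rw [(hf.pureJump r).tsum_eq] at h
    exact h.symm
  have htot : ∑' s, ENNReal.ofReal (Function.leftLim f s - f s) = 1 := by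
    refine le_antisymm ?_ ?_
    · rw [ENNReal.tsum_eq_iSup_sum]
      refine iSup_le fun F => ?_
      obtain ⟨r, hr⟩ := F.bddAbove
      calc ∑ s ∈ F, ENNReal.ofReal (Function.leftLim f s - f s)
          = ∑ s ∈ F, (Set.Iic r).indicator
              (fun s => ENNReal.ofReal (Function.leftLim f s - f s)) s :=
            Finset.sum_congr rfl fun s hs => by
              rw [Set.indicator_of_mem (show s ∈ Set.Iic r from hr hs)]
        _ ≤ _ := ENNReal.sum_le_tsum F
        _ = ENNReal.ofReal (1 - f r) := by rw [← tsum_subtype, hIic]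
        _ ≤ 1 := by
          rw [← ENNReal.ofReal_one]
          exact ENNReal.ofReal_le_ofReal (by linarith [hf.nonneg r])
    · have h : Tendsto (fun r => ENNReal.ofReal (1 - f r)) atTop (𝓝 1) := by
        have := ENNReal.tendsto_ofReal (hlim.const_sub 1)
        simpa using this
      refine le_of_tendsto' h fun r => ?_
      rw [← hIic r]
      exact ENNReal.tsum_comp_le_tsum_of_injective Subtype.val_injective _
  have hsplit : ENNReal.ofReal (1 - f t) + ∑' s, (Set.Ioi t).indicator
      (fun s => ENNReal.ofReal (Function.leftLim f s - f s)) s = 1 := by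
    rw [← htot, ← hIic t, ← tsum_subtype (Set.Ioi t), ← Set.compl_Iic]
    exact Summable.tsum_add_tsum_compl (s := Set.Iic t)
      (f := fun s => ENNReal.ofReal (Function.leftLim f s - f s))
      ENNReal.summable ENNReal.summable
  have hft : f t ≤ 1 := hf.start ▸ hf.antitone (zero_le : (0 : ℝ≥0) ≤ t)
  have hfin : ∑' s, (Set.Ioi t).indicator
      (fun s => ENNReal.ofReal (Function.leftLim f s - f s)) s = ENNReal.ofReal (f t) := by
    have h2 : ENNReal.ofReal (1 - f t) + ENNReal.ofReal (f t) = 1 := by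
      rw [← ENNReal.ofReal_add (by linarith) (hf.nonneg t)]; simp
    exact (ENNReal.add_right_inj ENNReal.ofReal_ne_top).1 (hsplit.trans h2.symm)
  rw [stringMeasure, Measure.sum_apply _ measurableSet_Ioi]
  simp only [Measure.smul_apply, smul_eq_mul, hterm]
  rw [ENNReal.tsum_mul_left, hfin, ENNReal.ofReal_mul hm.le]

/-! ### The growing trees

All strings are placed in the space of real sequences with the `ℓ¹`-distance, the `k`th string
being attached in the direction of the `k`th basis vector; the `ℓ¹`-distance restricted to the
resulting sets is the `ℝ`-tree distance. Strings and leaves are numbered `0, 1, 2, …` (not `1, 2, 3, …`),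
so the spine is `[[0, Σ_0]]` and the spinal partition is a partition of `{1, 2, 3, …}`. -/

/-- Ambient space of the trees. -/
abbrev Pt : Type := ℕ → ℝ

/-- The distance of the trees (all their points have finite support). -/
def treeDist (x y : Pt) : ℝ := ∑' i, |x i - y i|

/-- The point at distance `s` from `x` in the direction of the `k`th basis vector. -/
def extend (x : Pt) (k : ℕ) (s : ℝ) : Pt := x + Pi.single k s

section Tree

variable (α : ℝ) (f : ℕ → ℝ≥0 → ℝ) (J : ℕ → Pt)

/-- The mass measures: `μ₀` is the measure of the string of mass `1` associated with `f 0`;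
`μ_{n+1}` arises from `μ_n` by removing the bead at `J n`, of mass `m` say, and distributing this
mass over the string of beads of mass `m` associated with `f (n+1)`, attached at `J n`. -/
def massMeasure : ℕ → Measure Pt
  | 0 => (stringMeasure (f 0) α 1).map (extend 0 0)
  | n + 1 => (massMeasure n).restrict {J n}ᶜ +
      (stringMeasure (f (n + 1)) α (massMeasure n {J n}).toReal).map (extend (J n) (n + 1))

/-- Root vertex and attachment points: string `0` starts from the root, and string `n + 1`
starts from `J n`. -/
def base : ℕ → Pt
  | 0 => 0
  | n + 1 => J n

/-- Mass distributed over the `n`th string: `1` for `n = 0`, and the mass of the bead at `J n`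
for string `n + 1`. -/
def stringMass : ℕ → ℝ
  | 0 => 1
  | n + 1 => (massMeasure α f J n {J n}).toReal

/-- The length of the `n`th string. -/
def branchLength (n : ℕ) : ℝ := stringLength (f n) α (stringMass α f J n)

/-- The `n`th string, as the subset `[[J_{n-1}, Σ_n]]` of the tree. -/
def branch (n : ℕ) : Set Pt :=
  extend (base J n) n '' Set.Icc 0 (branchLength α f J n)

/-- The leaf `Σ_n`, the far end of the `n`th string. -/
def leaf (n : ℕ) : Pt := extend (base J n) n (branchLength α f J n)

/-- The tree `R_n` with leaves `Σ_0, …, Σ_n`. -/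
def tree (n : ℕ) : Set Pt := ⋃ k ≤ n, branch α f J k

/-- The union of all the trees `R_n`. -/
def fullTree : Set Pt := ⋃ n, tree α f J n

/-- The path `[[x, y]]` between two points of the tree. -/
def segment (x y : Pt) : Set Pt :=
  {z | z ∈ fullTree α f J ∧ treeDist x z + treeDist z y = treeDist x y}

/-- `b` is the branch point of the leaves `Σ_0` and `Σ_k`:
`[[0, b]] = [[0, Σ_0]] ∩ [[0, Σ_k]]`. -/
def IsBranchPoint (b : Pt) (k : ℕ) : Prop :=
  b ∈ fullTree α f J ∧
    segment α f J 0 b = segment α f J 0 (leaf α f J 0) ∩ segment α f J 0 (leaf α f J k)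

/-- The ordered spinal partition of `ℕ \ {0}` along the spine `[[0, Σ_0]]`: its block at
position `s` is the set of all `k ≥ 1` such that `Σ_k` branches off at distance `s` from the root.
Here `s ↦ extend 0 0 s` is the isometry of `[0, d(0, Σ_0)]` onto `[[0, Σ_0]]` fixing the root. -/
def spinalPartition (s : ℝ) : Set ℕ :=
  {k | 1 ≤ k ∧ s ∈ Set.Icc 0 (treeDist 0 (leaf α f J 0)) ∧ IsBranchPoint α f J (extend 0 0 s) k}

end Tree

/-! ### Bead splitting processes -/

section Stoch

variable {Ω : Type*} [mΩ : MeasurableSpace Ω]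

/-- The information on which the choice of `J n` depends: the paths `M 0, …, M n` and the earlier
junction points `J 0, …, J (n-1)`. -/
abbrev history (M : ℕ → ℝ≥0 → Ω → ℝ) (J : ℕ → Ω → Pt) (n : ℕ) : MeasurableSpace Ω :=
  (⨆ i : Fin (n + 1), ⨆ t : ℝ≥0, MeasurableSpace.comap (M i t) inferInstance) ⊔
    ⨆ i : Fin n, MeasurableSpace.comap (J i) inferInstance

/-- Bead splitting process with parameter `α > 0` based on decreasing pure jump processes
`M 0, M 1, …`, developing by size-biased branching: `J n` is picked from `R_n` according to
`μ_n`, i.e. the conditional distribution of `J n` given the history is `μ_n`. -/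
structure IsBeadSplittingProcess (P : Measure Ω) (α : ℝ) (M : ℕ → ℝ≥0 → Ω → ℝ)
    (J : ℕ → Ω → Pt) : Prop where
  alpha_pos : 0 < α
  measurable_M : ∀ n t, Measurable (M n t)
  path : ∀ n, ∀ᵐ ω ∂P, IsDecreasingPureJump (fun t => M n t ω)
  /-- The strings have finite lengths. -/
  integrable : ∀ n, ∀ᵐ ω ∂P,
    IntegrableOn (fun s : ℝ => M n s.toNNReal ω ^ α) (Set.Ioi 0)
  measurable_J : ∀ n, Measurable (J n)
  pick : ∀ n, ∀ A : Set Pt, MeasurableSet A → ∀ B : Set Ω, MeasurableSet[history M J n] B →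
    P (B ∩ J n ⁻¹' A) =
      ∫⁻ ω in B, massMeasure α (fun k t => M k t ω) (fun k => J k ω) n A ∂P

/-- The (random) ordered spinal partition of a bead splitting process. -/
def spinal (α : ℝ) (M : ℕ → ℝ≥0 → Ω → ℝ) (J : ℕ → Ω → Pt) (ω : Ω) : ℝ → Set ℕ :=
  spinalPartition α (fun k t => M k t ω) (fun k => J k ω)

/-- A pure jump subordinator: `ξ 0 = 0`, independent and stationary increments, nondecreasing
right-continuous paths that are the sums of their jumps (zero drift, no killing). -/
structure IsPureJumpSubordinator (P : Measure Ω) (ξ : ℝ≥0 → Ω → ℝ) : Prop where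
  measurable : ∀ t, Measurable (ξ t)
  start : ∀ᵐ ω ∂P, ξ 0 ω = 0
  indep : HasIndepIncrements ξ P
  stationary : ∀ s t : ℝ≥0, IdentDistrib (fun ω => ξ (s + t) ω - ξ s ω) (ξ t) P P
  path : ∀ᵐ ω ∂P, Monotone (fun t => ξ t ω) ∧
    (∀ t, ContinuousWithinAt (fun t => ξ t ω) (Set.Ioi t) t) ∧
    ∀ t, HasSum (fun s : Set.Iic t => ξ s.1 ω - Function.leftLim (fun r => ξ r ω) s.1) (ξ t ω)

/-- A fragmenter (multiplicative subordinator): `M_t = exp (-ξ_t)` for a pure jump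
subordinator `ξ`. -/
def IsFragmenter (P : Measure Ω) (M : ℝ≥0 → Ω → ℝ) : Prop :=
  ∃ ξ : ℝ≥0 → Ω → ℝ, IsPureJumpSubordinator P ξ ∧
    ∀ᵐ ω ∂P, ∀ t, M t ω = Real.exp (-ξ t ω)

/-! ### Exchangeability -/

/-- The point process `∑ δ_{(s, Q_s)}` over all `s` with `Q_s ≠ ∅`, as a random measure. -/
def pointMeasure (Q : ℝ → Set ℕ) : Measure (ℝ × Set ℕ) :=
  Measure.sum fun s : {s : ℝ // (Q s).Nonempty} => Measure.dirac (s.1, Q s.1)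

/-- `Q` is almost surely an ordered partition of `ℕ \ {0}`. -/
def IsOrderedPartition (P : Measure Ω) (Q : Ω → ℝ → Set ℕ) : Prop :=
  ∀ᵐ ω ∂P, (∀ s, 0 ∉ Q ω s) ∧ ∀ k, 1 ≤ k → ∃! s, k ∈ Q ω s

/-- The distribution of the point process `(Q_s)` is invariant under permutations of
`ℕ \ {0}`. -/
def IsExchangeable (P : Measure Ω) (Q : Ω → ℝ → Set ℕ) : Prop :=
  ∀ σ : Equiv.Perm ℕ, σ 0 = 0 →
    IdentDistrib (fun ω => pointMeasure fun s => σ '' Q ω s) (fun ω => pointMeasure (Q ω)) P P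

/-! ### Composition structures -/

/-- `l` is a composition of `n`: a sequence of positive integers with sum `n`. -/
def IsComposition (n : ℕ) (l : List ℕ) : Prop := (∀ b ∈ l, 0 < b) ∧ l.sum = n

open Classical in
/-- The vector of nonzero sizes `#(Q_s ∩ {1, …, n})`, in the order of the positions `s`. -/
def blockSizes (Q : ℝ → Set ℕ) (n : ℕ) : List ℕ :=
  if h : {s : ℝ | (Q s ∩ Set.Icc 1 n).Nonempty}.Finite then
    (h.toFinset.sort (· ≤ ·)).map fun s => (Q s ∩ Set.Icc 1 n).ncard
  else []

/-- Remove one ball from the `j`th box of `l`, and delete the box if it becomes empty. -/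
def removeBall (l : List ℕ) (j : ℕ) : List ℕ := (l.modify j (· - 1)).filter (0 < ·)

/-- Probability that removing a uniformly chosen ball turns `l` into `l'`. -/
def removalProb (l l' : List ℕ) : ℝ≥0∞ :=
  ∑ j : Fin l.length, if removeBall l j = l' then (l.get j : ℝ≥0∞) / (l.sum : ℝ≥0∞) else 0

/-- `C n` is a random composition of `n`, for every `n`. -/
def IsRandomComposition (P : Measure Ω) (C : ℕ → Ω → List ℕ) : Prop :=
  ∀ n, (∀ᵐ ω ∂P, IsComposition n (C n ω)) ∧ ∀ l, NullMeasurableSet {ω | C n ω = l} P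

/-- Strong sampling consistency: conditionally given `C (n+1), C (n+2), …`, the composition `C n`
is obtained from `C (n+1)` by removing a ball chosen uniformly at random. -/
def StronglySamplingConsistent (P : Measure Ω) (C : ℕ → Ω → List ℕ) : Prop :=
  ∀ n N : ℕ, n < N → ∀ c : ℕ → List ℕ,
    P {ω | ∀ i ∈ Set.Icc n N, C i ω = c i} =
      removalProb (c (n + 1)) (c n) * P {ω | ∀ i ∈ Set.Icc (n + 1) N, C i ω = c i}

/-- Regenerative compositions: conditionally given that the first part of `C n` is `m < n`, the
remaining composition of `n - m` is distributed like `C (n - m)`. -/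
def Regenerative (P : Measure Ω) (C : ℕ → Ω → List ℕ) : Prop :=
  ∀ n m : ℕ, 1 ≤ m → m < n → ∀ l : List ℕ,
    P {ω | C n ω = m :: l} = P {ω | (C n ω).head? = some m} * P {ω | C (n - m) ω = l}

end Stoch

end

end BeadSplitting

/-! Only the projection to the spine matters. In the `ℓ¹` picture the spine is the axis of
coordinate `0`, and leaf `n + 1` branches off at height `J n 0`. Splitting a bead replaces its mass
by a string of equal total mass along which coordinate `0` is constant, so the image of every `μ_n`
under this coordinate is the string measure of `M 0` (`massMeasure_zero_coord`). Hence, given the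
path of `M 0`, the heights `branchPos` are independent with this common law, whatever the joint law
of the other paths (`lintegral_prod`). The spinal partition consists almost surely of their level
sets (`ae_spinal_eq`).

Exchangeability of a conditionally i.i.d. sequence gives exchangeability of the partition. It also
gives sampling consistency: the last ball of the composition of `n + 1` may be swapped with any
other without changing the later compositions, so it is a uniformly chosen one
(`measure_levelSizes_erase`).

For regeneration, time is cut into cells of length `h`. Given the path, a branch time falls into
cell `k` with probability `M 0 (k h) - M 0 ((k + 1) h)`, a jump of a multiplicative random walk.
After the first occupied cell this walk restarts as an independent copy multiplied by its current
value. The multiplier enters the joint cell probabilities of the `r` remaining indices only as its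
`r`th power, so the law of their cells relative to the first occupied one is the unconditional law
up to a constant (`measure_first_cell`). Summing over the first cell and its occupants gives the
regenerative identity on the grid. As `h → 0` the cells eventually have the same order pattern as
the heights, and the identity passes to the limit. -/

namespace BeadSplitting

/-! ### Compositions of level sets -/

section Comp

variable {ι γ γ' : Type*} [LinearOrder γ] [LinearOrder γ']

/-- Sizes of the level sets of `z` on `s`, by increasing level. -/
def levelSizes (s : Finset ι) (z : ι → γ) : List ℕ :=
  ((s.image z).sort (· ≤ ·)).map fun v => (s.filter fun i => z i = v).card

@[simp] lemma levelSizes_empty (z : ι → γ) : levelSizes ∅ z = [] := by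
  simp [levelSizes]

variable [DecidableEq ι]

/-- This recursion, peeling off the lowest level set, is what the inductive arguments about
`levelSizes` rest on. -/
lemma levelSizes_union {A R : Finset ι} {z : ι → γ} {v : γ} (hA : A.Nonempty)
    (hz : ∀ i ∈ A, z i = v) (hR : ∀ i ∈ R, v < z i) :
    levelSizes (A ∪ R) z = A.card :: levelSizes R z := by
  have himg : (A ∪ R).image z = insert v (R.image z) := by
    ext x
    simp only [Finset.mem_image, Finset.mem_union, Finset.mem_insert]
    constructor
    · rintro ⟨i, hi | hi, rfl⟩
      · exact Or.inl (hz i hi)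
      · exact Or.inr ⟨i, hi, rfl⟩
    · rintro (rfl | ⟨i, hi, rfl⟩)
      · obtain ⟨i, hi⟩ := hA
        exact ⟨i, Or.inl hi, hz i hi⟩
      · exact ⟨i, Or.inr hi, rfl⟩
  have hlt : ∀ b ∈ R.image z, v < b := by
    simp only [Finset.mem_image]
    rintro _ ⟨i, hi, rfl⟩
    exact hR i hi
  have hfil : (A ∪ R).filter (fun i => z i = v) = A := by
    ext i
    simp only [Finset.mem_filter, Finset.mem_union]
    exact ⟨fun h => h.1.resolve_right fun hi => (hR i hi).ne' h.2, fun h => ⟨Or.inl h, hz i h⟩⟩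
  rw [levelSizes, himg, Finset.sort_insert (· ≤ ·) (fun b hb => (hlt b hb).le)
    (fun h => (hlt v h).false), List.map_cons, hfil, levelSizes]
  congr 1
  refine List.map_congr_left fun b hb => ?_
  rw [Finset.mem_sort] at hb
  congr 1
  ext i
  simp only [Finset.mem_filter, Finset.mem_union]
  refine ⟨fun h => ⟨h.1.resolve_left fun hi => ?_, h.2⟩, fun h => ⟨Or.inr h.1, h.2⟩⟩
  exact (hlt b hb).ne ((hz i hi).symm.trans h.2)

/-- A nonempty set splits into the lowest level set and the rest. -/
lemma exists_lowest_level (s : Finset ι) (hs : s.Nonempty) (z : ι → γ) :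
    ∃ A R : Finset ι, ∃ v, A ∪ R = s ∧ Disjoint A R ∧ A.Nonempty ∧ (∀ i ∈ A, z i = v) ∧
      ∀ i ∈ R, v < z i := by
  obtain ⟨j, hj, hmin⟩ := s.exists_min_image z hs
  refine ⟨s.filter (fun i => z i = z j), s.filter (fun i => ¬ z i = z j), z j,
    Finset.filter_union_filter_not_eq _ _, Finset.disjoint_filter_filter_not _ _ _,
    ⟨j, by simp [hj]⟩, by simp, ?_⟩
  intro i hi
  rw [Finset.mem_filter] at hi
  exact lt_of_le_of_ne (hmin i hi.1) (Ne.symm hi.2)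

lemma levelSizes_induction {motive : Finset ι → Prop} (z : ι → γ) (empty : motive ∅)
    (union : ∀ (A R : Finset ι) (v : γ), Disjoint A R → A.Nonempty → (∀ i ∈ A, z i = v) →
      (∀ i ∈ R, v < z i) → motive R → motive (A ∪ R)) (s : Finset ι) : motive s := by
  induction s using Finset.strongInduction with
  | H s ih =>
    rcases s.eq_empty_or_nonempty with rfl | hs
    · exact empty
    · obtain ⟨A, R, v, rfl, hd, hA, hz, hR⟩ := exists_lowest_level s hs z
      refine union A R v hd hA hz hR (ih R ?_)
      refine Finset.ssubset_iff_subset_ne.2 ⟨Finset.subset_union_right, fun h => ?_⟩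
      obtain ⟨i, hi⟩ := hA
      exact Finset.disjoint_left.1 hd hi (h ▸ Finset.mem_union_left _ hi)

lemma isComposition_levelSizes (s : Finset ι) (z : ι → γ) :
    IsComposition s.card (levelSizes s z) := by
  induction s using levelSizes_induction z with
  | empty => simp [IsComposition]
  | union A R v hd hA hz hR ih =>
    rw [levelSizes_union hA hz hR, Finset.card_union_of_disjoint hd]
    refine ⟨?_, by rw [List.sum_cons, ih.2]⟩
    simp only [List.mem_cons, forall_eq_or_imp]
    exact ⟨hA.card_pos, ih.1⟩

/-- The sizes of the level sets depend only on the order of the values. -/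
lemma levelSizes_congr (s : Finset ι) {z : ι → γ} {z' : ι → γ'}
    (h : ∀ i ∈ s, ∀ j ∈ s, z i ≤ z j ↔ z' i ≤ z' j) : levelSizes s z = levelSizes s z' := by
  induction s using levelSizes_induction z with
  | empty => simp
  | union A R v hd hA hz hR ih =>
    have hlt : ∀ i ∈ A ∪ R, ∀ j ∈ A ∪ R, z i < z j ↔ z' i < z' j := fun i hi j hj => by
      rw [← not_le, ← not_le, h j hj i hi]
    obtain ⟨a, ha⟩ := hA
    have haU := Finset.mem_union_left R ha
    rw [levelSizes_union ⟨a, ha⟩ hz hR, levelSizes_union (v := z' a) ⟨a, ha⟩, ih]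
    · exact fun i hi j hj =>
        h i (Finset.mem_union_right _ hi) j (Finset.mem_union_right _ hj)
    · intro i hi
      have hiU := Finset.mem_union_left R hi
      exact le_antisymm ((h i hiU a haU).1 (by rw [hz i hi, hz a ha]))
        ((h a haU i hiU).1 (by rw [hz i hi, hz a ha]))
    · intro i hi
      exact (hlt a haU i (Finset.mem_union_right _ hi)).1 (by rw [hz a ha]; exact hR i hi)

lemma levelSizes_image {κ : Type*} [DecidableEq κ] (s : Finset κ) (e : κ → ι)
    (he : Function.Injective e) (z : ι → γ) :
    levelSizes (s.image e) z = levelSizes s (z ∘ e) := by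
  rw [levelSizes, levelSizes, Finset.image_image]
  refine List.map_congr_left fun v _ => ?_
  rw [Finset.filter_image, Finset.card_image_of_injective _ he]
  rfl

/-- Resolves the event of a given first part according to the lowest level `v` and the set `A`
attaining it; the regeneration argument sums over these choices. -/
lemma levelSizes_eq_cons_iff {s : Finset ι} {z : ι → γ} {m : ℕ} {l : List ℕ} :
    levelSizes s z = m :: l ↔ ∃ A ∈ s.powersetCard m, A.Nonempty ∧ ∃ v, (∀ i ∈ A, z i = v) ∧
      (∀ i ∈ s \ A, v < z i) ∧ levelSizes (s \ A) z = l := by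
  constructor
  · intro h
    rcases s.eq_empty_or_nonempty with rfl | hs
    · simp at h
    · obtain ⟨A, R, v, rfl, hd, hA, hz, hR⟩ := exists_lowest_level s hs z
      rw [levelSizes_union hA hz hR, List.cons.injEq] at h
      have hR' : (A ∪ R) \ A = R := Finset.union_sdiff_cancel_left hd
      refine ⟨A, Finset.mem_powersetCard.2 ⟨Finset.subset_union_left, h.1⟩, hA, v, hz, ?_⟩
      rw [hR']
      exact ⟨hR, h.2⟩
  · rintro ⟨A, hAs, hA, v, hz, hR, hl⟩
    rw [Finset.mem_powersetCard] at hAs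
    rw [← Finset.union_sdiff_of_subset hAs.1, levelSizes_union hA hz hR, hl, hAs.2]

lemma removeBall_zero {a : ℕ} {l : List ℕ} (hl : ∀ b ∈ l, 0 < b) :
    removeBall (a :: l) 0 = if a ≤ 1 then l else (a - 1) :: l := by
  have hf : l.filter (0 < ·) = l := List.filter_eq_self.2 (by simpa using hl)
  rw [removeBall, List.modify_zero_cons, List.filter_cons, hf]
  by_cases h : a ≤ 1
  · simp [h]
  · have : 1 < a := by omega
    simp [h, this]

lemma removeBall_succ {a : ℕ} {l : List ℕ} (ha : 0 < a) (j : ℕ) :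
    removeBall (a :: l) (j + 1) = a :: removeBall l j := by
  simp [removeBall, List.modify_succ_cons, ha]

/-- Removing each element in turn removes balls from the boxes, from each box as often as its
size says. -/
lemma sum_levelSizes_erase (s : Finset ι) (z : ι → γ) (g : List ℕ → ℝ≥0∞) :
    ∑ j ∈ s, g (levelSizes (s.erase j) z) = ∑ b : Fin (levelSizes s z).length,
      ((levelSizes s z).get b : ℝ≥0∞) * g (removeBall (levelSizes s z) b) := by
  induction s using levelSizes_induction z generalizing g with
  | empty =>
    rw [levelSizes_empty, Finset.sum_empty]
    exact (Fin.sum_univ_zero _).symm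
  | union A R v hd hA hz hR ih =>
    have hA0 := hA.card_pos
    have hpos := (isComposition_levelSizes R z).1
    rw [levelSizes_union hA hz hR, Finset.sum_union hd]
    simp only [List.length_cons, Fin.sum_univ_succ, List.get_cons_zero, Fin.val_zero,
      List.get_cons_succ', Fin.val_succ, removeBall_zero hpos, removeBall_succ hA0]
    -- Removing an element of `R` leaves the first box intact, so the induction hypothesis is needed
    -- for `g` with that box prepended.
    rw [← ih fun l => g (A.card :: l)]
    congr 1
    · rw [← nsmul_eq_mul]
      refine Finset.sum_eq_card_nsmul fun j hj => ?_
      have hjR : j ∉ R := Finset.disjoint_left.1 hd hj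
      rw [Finset.erase_union_distrib, Finset.erase_eq_of_notMem hjR]
      by_cases h1 : A.card ≤ 1
      · have : A.erase j = ∅ := by
          rw [← Finset.card_eq_zero, Finset.card_erase_of_mem hj]; omega
        rw [if_pos h1, this, Finset.empty_union]
      · have hc := Finset.card_erase_of_mem hj
        rw [if_neg h1, levelSizes_union (v := v) (Finset.card_pos.1 (by omega))
          (fun i hi => hz i (Finset.mem_of_mem_erase hi)) hR, hc]
    · refine Finset.sum_congr rfl fun j hj => ?_
      have hjA : j ∉ A := Finset.disjoint_right.1 hd hj
      rw [Finset.erase_union_distrib, Finset.erase_eq_of_notMem hjA, levelSizes_union hA hz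
        fun i hi => hR i (Finset.mem_of_mem_erase hi)]

end Comp

/-- By `levelSizes_congr` the composition is a function of the pattern of comparisons within `s`,
which is a measurable map into a finite space. -/
lemma measurableSet_levelSizes_eq {γ : Type*} [LinearOrder γ] [MeasurableSpace γ]
    [TopologicalSpace γ] [OrderClosedTopology γ] [OpensMeasurableSpace γ]
    [SecondCountableTopology γ] (s : Finset ℕ) (l : List ℕ) :
    MeasurableSet {z : ℕ → γ | levelSizes s z = l} := by
  classical
  set pat : (ℕ → γ) → s × s → Prop := fun z p => z p.1 ≤ z p.2 with hpat
  have hm : Measurable pat := by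
    refine measurable_pi_iff.2 fun p => ?_
    exact measurable_to_prop (by
      simpa [Set.preimage, hpat] using
        measurableSet_le (measurable_pi_apply (p.1 : ℕ)) (measurable_pi_apply (p.2 : ℕ)))
  have : {z : ℕ → γ | levelSizes s z = l} = pat ⁻¹' (pat '' {z | levelSizes s z = l}) := by
    refine (Set.subset_preimage_image _ _).antisymm ?_
    rintro z ⟨z', hz', he⟩
    rw [Set.mem_ofPred_eq, ← show levelSizes s z' = l from hz']
    refine levelSizes_congr s fun i hi j hj => ?_
    exact (congrFun he (⟨i, hi⟩, ⟨j, hj⟩)).symm.to_iff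
  rw [this]
  exact hm (Set.toFinite _).measurableSet

/-- Partition of `{1, 2, …}` into the level sets of `z`, where `z k` is the level of `k + 1`. -/
def levelPartition (z : ℕ → ℝ) (s : ℝ) : Set ℕ := {k | 1 ≤ k ∧ z (k - 1) = s}

lemma ncard_levelPartition (z : ℕ → ℝ) (n : ℕ) (s : ℝ) :
    (levelPartition z s ∩ Set.Icc 1 n).ncard = ((Finset.range n).filter fun i => z i = s).card := by
  have : levelPartition z s ∩ Set.Icc 1 n =
      Nat.succ '' ((Finset.range n).filter fun i => z i = s : Finset ℕ) := by
    ext k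
    simp only [levelPartition, Set.mem_inter_iff, Set.mem_ofPred_eq, Set.mem_Icc, Set.mem_image,
      Finset.coe_filter, Finset.mem_range]
    constructor
    · rintro ⟨⟨h1, h2⟩, -, h3⟩
      exact ⟨k - 1, ⟨by omega, h2⟩, by omega⟩
    · rintro ⟨i, ⟨h1, h2⟩, rfl⟩
      exact ⟨⟨by omega, h2⟩, by omega, by omega⟩
  rw [this, Set.ncard_image_of_injective _ Nat.succ_injective, Set.ncard_coe_finset]

/-- Finitely many indices occupy finitely many levels, so the default value `[]` in `blockSizes`
plays no role. -/
lemma blockSizes_levelPartition (z : ℕ → ℝ) (n : ℕ) :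
    blockSizes (levelPartition z) n = levelSizes (Finset.range n) z := by
  have hset : {s : ℝ | (levelPartition z s ∩ Set.Icc 1 n).Nonempty} =
      ((Finset.range n).image z : Finset ℝ) := by
    ext s
    simp only [levelPartition, Set.Nonempty, Set.mem_inter_iff, Set.mem_ofPred_eq, Set.mem_Icc,
      Finset.coe_image, Set.mem_image, Finset.coe_range, Set.mem_Iio]
    constructor
    · rintro ⟨k, ⟨h1, h2⟩, -, h3⟩
      exact ⟨k - 1, by omega, h2⟩
    · rintro ⟨i, h1, h2⟩
      exact ⟨i + 1, ⟨by omega, by simpa using h2⟩, by omega, by omega⟩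
  have hfin : {s : ℝ | (levelPartition z s ∩ Set.Icc 1 n).Nonempty}.Finite := by
    rw [hset]; exact Finset.finite_toSet _
  rw [blockSizes, dif_pos hfin, levelSizes]
  have : hfin.toFinset = (Finset.range n).image z := by
    rw [← Finset.coe_inj, Set.Finite.coe_toFinset, hset]
  rw [this]
  exact List.map_congr_left fun s _ => ncard_levelPartition z n s

/-! ### A single string of beads -/

section Strings

variable {f : ℝ≥0 → ℝ} {α m : ℝ}

lemma IsDecreasingPureJump.le_one (hf : IsDecreasingPureJump f) (t : ℝ≥0) : f t ≤ 1 :=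
  hf.start ▸ hf.antitone (zero_le : (0 : ℝ≥0) ≤ t)

lemma IsDecreasingPureJump.antitone_rpow (hf : IsDecreasingPureJump f) (hα : 0 < α) :
    Antitone fun s : ℝ => f s.toNNReal ^ α := fun _ _ h =>
  Real.rpow_le_rpow (hf.nonneg _) (hf.antitone (Real.toNNReal_mono h)) hα.le

lemma IsDecreasingPureJump.rpow_le_one (hf : IsDecreasingPureJump f) (hα : 0 < α) (t : ℝ≥0) :
    f t ^ α ≤ 1 :=
  Real.rpow_le_one (hf.nonneg _) (hf.le_one _) hα.le

lemma stringPos_zero : stringPos f α m 0 = 0 := by simp [stringPos]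

lemma stringPos_sub (hf : IsDecreasingPureJump f) (hα : 0 < α) (a b : ℝ≥0) :
    stringPos f α m b - stringPos f α m a = m ^ α * ∫ s in (a : ℝ)..b, f s.toNNReal ^ α := by
  have hII : ∀ a b : ℝ, IntervalIntegrable (fun s : ℝ => f s.toNNReal ^ α) volume a b :=
    fun a b => (hf.antitone_rpow hα).intervalIntegrable
  rw [stringPos, stringPos, ← mul_sub]
  congr 1
  linarith [intervalIntegral.integral_add_adjacent_intervals (hII 0 a) (hII a b)]

lemma stringPos_mono (hf : IsDecreasingPureJump f) (hα : 0 < α) (hm : 0 ≤ m) :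
    Monotone (stringPos f α m) := fun a b hab => by
  have : 0 ≤ ∫ s in (a : ℝ)..b, f s.toNNReal ^ α :=
    intervalIntegral.integral_nonneg (by exact_mod_cast hab)
      fun s _ => Real.rpow_nonneg (hf.nonneg _) _
  linarith [stringPos_sub (m := m) hf hα a b, mul_nonneg (Real.rpow_nonneg hm α) this]

lemma stringPos_nonneg (hf : IsDecreasingPureJump f) (hα : 0 < α) (hm : 0 ≤ m) (t : ℝ≥0) :
    0 ≤ stringPos f α m t :=
  stringPos_zero (f := f) (α := α) (m := m) ▸ stringPos_mono hf hα hm zero_le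

lemma stringPos_sub_le (hf : IsDecreasingPureJump f) (hα : 0 < α) {a b : ℝ≥0} (hab : a ≤ b) :
    stringPos f α 1 b - stringPos f α 1 a ≤ b - a := by
  rw [stringPos_sub hf hα, Real.one_rpow, one_mul]
  calc ∫ s in (a : ℝ)..b, f s.toNNReal ^ α ≤ ∫ _ in (a : ℝ)..b, (1 : ℝ) :=
        intervalIntegral.integral_mono_on (by exact_mod_cast hab)
          (hf.antitone_rpow hα).intervalIntegrable (by simp) fun s _ => hf.rpow_le_one hα _
    _ = b - a := by simp

lemma continuous_stringPos (hf : IsDecreasingPureJump f) (hα : 0 < α) :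
    Continuous (stringPos f α 1) := by
  refine LipschitzWith.continuous (K := 1) (LipschitzWith.of_le_add fun a b => ?_)
  rcases le_total a b with h | h
  · exact (stringPos_mono hf hα zero_le_one h).trans (le_add_of_nonneg_right dist_nonneg)
  · have := stringPos_sub_le hf hα h
    rw [NNReal.dist_eq, abs_of_nonneg (sub_nonneg.2 (by exact_mod_cast h))]
    linarith

lemma stringLength_nonneg (hf : IsDecreasingPureJump f) (hm : 0 ≤ m) :
    0 ≤ stringLength f α m :=
  mul_nonneg (Real.rpow_nonneg hm α) (integral_nonneg fun _ => Real.rpow_nonneg (hf.nonneg _) _)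

lemma stringPos_le_stringLength (hf : IsDecreasingPureJump f) (hm : 0 ≤ m)
    (hint : IntegrableOn (fun s : ℝ => f s.toNNReal ^ α) (Set.Ioi 0)) (t : ℝ≥0) :
    stringPos f α m t ≤ stringLength f α m := by
  rw [stringPos, stringLength, intervalIntegral.integral_of_le t.coe_nonneg]
  exact mul_le_mul_of_nonneg_left (setIntegral_mono_set hint
    (ae_of_all _ fun _ => Real.rpow_nonneg (hf.nonneg _) _)
    (Set.Ioc_subset_Ioi_self).eventuallyLE) (Real.rpow_nonneg hm α)

/-- The measure is a sum of atoms, so null sets are recognised by looking at the positions of jump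
times only. -/
lemma stringMeasure_eq_zero_of_forall (hm : 0 ≤ m) {A : Set ℝ} (hA : MeasurableSet A)
    (h : ∀ t, f t < Function.leftLim f t → stringPos f α m t ∉ A) :
    stringMeasure f α m A = 0 := by
  rw [stringMeasure, Measure.sum_apply _ hA, ENNReal.tsum_eq_zero]
  intro t
  by_cases ht : f t < Function.leftLim f t
  · simp [Measure.dirac_apply' _ hA, h t ht]
  · rw [ENNReal.ofReal_of_nonpos (mul_nonpos_of_nonneg_of_nonpos hm (by linarith))]; simp

lemma stringMeasure_zero : stringMeasure f α 0 = 0 := by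
  simp [stringMeasure]

/-- If a jump time `t` had position `0`, the tail formula at `t` and at `0` would give `f t = f 0 =
1`. Then `f = 1` on `[0, t]` and the position would be `m ^ α * t`, which forces `t = 0`; but there
is no jump at `0`. -/
lemma stringMeasure_Iic_zero (hf : IsDecreasingPureJump f) (hα : 0 < α) (hm : 0 < m)
    (hint : IntegrableOn (fun s : ℝ => f s.toNNReal ^ α) (Set.Ioi 0)) :
    stringMeasure f α m (Set.Iic 0) = 0 := by
  refine stringMeasure_eq_zero_of_forall hm.le measurableSet_Iic fun t ht hle => ?_
  have h0 : stringPos f α m t = 0 := le_antisymm hle (stringPos_nonneg hf hα hm.le t)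
  have h1 := stringMeasure_tail hf hα hm hint t
  rw [h0, ← stringPos_zero (f := f) (α := α) (m := m), stringMeasure_tail hf hα hm hint,
    ENNReal.ofReal_eq_ofReal_iff (mul_nonneg hm.le (hf.nonneg _))
    (mul_nonneg hm.le (hf.nonneg _)), mul_right_inj' hm.ne', hf.start] at h1
  have ht0 : t ≠ 0 := by
    rintro rfl
    rw [leftLim_eq_of_isBot (fun _ => zero_le)] at ht
    exact ht.false
  have h2 : ∫ s in (0 : ℝ)..t, f s.toNNReal ^ α = t := by
    have : ∫ s in (0 : ℝ)..t, f s.toNNReal ^ α = ∫ s in (0 : ℝ)..t, (1 : ℝ) := by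
      refine intervalIntegral.integral_congr fun s hs => ?_
      rw [Set.uIcc_of_le t.coe_nonneg] at hs
      have : f s.toNNReal = 1 := le_antisymm (hf.le_one _)
        (h1 ▸ hf.antitone (Real.toNNReal_le_iff_le_coe.2 hs.2))
      simp [this]
    simp [this]
  rw [stringPos, h2] at h0
  have := mul_pos (Real.rpow_pos_of_pos hm α) (NNReal.coe_pos.2 (pos_iff_ne_zero.2 ht0))
  exact this.ne' h0

lemma stringMeasure_univ (hf : IsDecreasingPureJump f) (hα : 0 < α) (hm : 0 ≤ m)
    (hint : IntegrableOn (fun s : ℝ => f s.toNNReal ^ α) (Set.Ioi 0)) :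
    stringMeasure f α m Set.univ = ENNReal.ofReal m := by
  rcases hm.eq_or_lt with rfl | hm
  · simp [stringMeasure_zero]
  have h := stringMeasure_tail hf hα hm hint 0
  rw [stringPos_zero, hf.start, mul_one] at h
  rw [← measure_add_measure_compl measurableSet_Iic, stringMeasure_Iic_zero hf hα hm hint,
    Set.compl_Iic, h, zero_add]

/-- The tails of a string measure in terms of countably many path values and positions. -/
lemma stringMeasure_Ioi (hf : IsDecreasingPureJump f) (hα : 0 < α)
    (hint : IntegrableOn (fun s : ℝ => f s.toNNReal ^ α) (Set.Ioi 0)) (a : ℝ) :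
    stringMeasure f α 1 (Set.Ioi a) = ⨆ q : ℚ,
      if a < stringPos f α 1 (q : ℝ).toNNReal then ENNReal.ofReal (f (q : ℝ).toNNReal) else 0 := by
  have htail := fun t => stringMeasure_tail hf hα one_pos hint t
  simp only [one_mul] at htail
  refine le_antisymm ?_ (iSup_le fun q => ?_)
  swap
  · split_ifs with h
    · rw [← htail]
      exact measure_mono (Set.Ioi_subset_Ioi h.le)
    · exact zero_le
  by_cases hne : ∃ t, a < stringPos f α 1 t
  swap
  · push Not at hne
    rw [stringMeasure_eq_zero_of_forall zero_le_one measurableSet_Ioi fun t _ => (hne t).not_gt]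
    exact zero_le
  obtain ⟨u, hu⟩ := hne
  rcases lt_or_ge a 0 with ha | ha
  · refine le_trans ?_ (le_iSup _ (0 : ℚ))
    simp only [Rat.cast_zero, Real.toNNReal_zero, stringPos_zero, ha, if_true, hf.start]
    exact (measure_mono (Set.subset_univ _)).trans
      (stringMeasure_univ hf hα zero_le_one hint).le
  · have hmono := stringPos_mono (m := 1) hf hα zero_le_one
    have hcl : IsClosed {t | stringPos f α 1 t ≤ a} :=
      isClosed_le (continuous_stringPos hf hα) continuous_const
    have hbdd : BddAbove {t | stringPos f α 1 t ≤ a} :=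
      ⟨u, fun t ht => (hmono.reflect_lt (lt_of_le_of_lt ht hu)).le⟩
    have hmem := hcl.csSup_mem ⟨0, by simpa [stringPos_zero] using ha⟩ hbdd
    -- `τ` is the last time with position at most `a`, so the tail beyond `a` is bounded by `f τ`.
    -- By right-continuity `f τ` is a limit of values from the right, and these are bounded by
    -- values at rational times just after `τ`.
    set τ := sSup {t | stringPos f α 1 t ≤ a} with hτ
    have hgt : ∀ q, τ < q → a < stringPos f α 1 q := fun q hq => by
      by_contra h
      exact (le_csSup hbdd (not_lt.1 h)).not_gt hq
    calc stringMeasure f α 1 (Set.Ioi a) ≤ stringMeasure f α 1 (Set.Ioi (stringPos f α 1 τ)) :=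
          measure_mono (Set.Ioi_subset_Ioi hmem)
      _ = ENNReal.ofReal (f τ) := htail τ
      _ ≤ _ := by
        have hlim : Tendsto (fun q => ENNReal.ofReal (f q)) (𝓝[>] τ) (𝓝 (ENNReal.ofReal (f τ))) :=
          (ENNReal.continuous_ofReal.tendsto _).comp (hf.rightCts τ)
        refine le_of_tendsto hlim ?_
        filter_upwards [self_mem_nhdsWithin] with r hr
        obtain ⟨q, hq1, hq2⟩ := exists_rat_btwn (NNReal.coe_lt_coe.2 (Set.mem_Ioi.1 hr))
        have hq0 : 0 ≤ (q : ℝ) := τ.2.trans hq1.le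
        have hqτ : τ < (q : ℝ).toNNReal := Real.lt_toNNReal_iff_coe_lt.2 hq1
        have hqr : (q : ℝ).toNNReal ≤ r := Real.toNNReal_le_iff_le_coe.2 hq2.le
        refine le_trans ?_ (le_iSup _ q)
        rw [if_pos (hgt _ hqτ)]
        exact ENNReal.ofReal_le_ofReal (hf.antitone hqr)

/-- Right Riemann sums for the position on the string of mass `1`. -/
noncomputable def posApprox (α : ℝ) (f : ℝ≥0 → ℝ) (t : ℝ≥0) (n : ℕ) : ℝ :=
  t / (n + 1) * ∑ i ∈ Finset.range (n + 1), f (((i + 1 : ℕ) : ℝ) * (t / (n + 1))).toNNReal ^ α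

lemma tendsto_posApprox (hf : IsDecreasingPureJump f) (hα : 0 < α) (t : ℝ≥0) :
    Tendsto (posApprox α f t) atTop (𝓝 (stringPos f α 1 t)) := by
  rcases eq_or_ne t 0 with rfl | ht
  · have : posApprox α f 0 = fun _ => 0 := by ext n; simp [posApprox]
    rw [this, stringPos_zero]
    exact tendsto_const_nhds
  have ht : (0 : ℝ) < t := NNReal.coe_pos.2 (pos_iff_ne_zero.2 ht)
  have hbound : ∀ n : ℕ, posApprox α f t n ≤ stringPos f α 1 t ∧
      stringPos f α 1 t ≤ posApprox α f t n + t / (n + 1) := by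
    intro n
    set c : ℝ := t / (n + 1) with hc
    have hn : (0 : ℝ) < (n : ℝ) + 1 := by positivity
    have hc0 : 0 < c := div_pos ht hn
    -- Rescaling time by the mesh `c` allows comparison of the integral with sums over integers.
    set G : ℝ → ℝ := fun x => f (x * c).toNNReal ^ α with hG
    have hanti : Antitone G := fun x y hxy =>
      hf.antitone_rpow hα (mul_le_mul_of_nonneg_right hxy hc0.le)
    have h1 := AntitoneOn.sum_le_integral (x₀ := 0) (a := n + 1) (hanti.antitoneOn _)
    have h2 := AntitoneOn.integral_le_sum (x₀ := 0) (a := n + 1) (hanti.antitoneOn _)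
    have hI : ∫ x in (0 : ℝ)..(0 + ((n + 1 : ℕ) : ℝ)), G x = c⁻¹ * stringPos f α 1 t := by
      rw [hG, intervalIntegral.integral_comp_mul_right (fun x => f x.toNNReal ^ α) hc0.ne',
        stringPos, Real.one_rpow, one_mul, smul_eq_mul, zero_mul, zero_add]
      congr 2
      push_cast
      rw [hc]; field_simp
    rw [hI] at h1 h2
    simp only [zero_add] at h1 h2
    have hA : posApprox α f t n = c * ∑ i ∈ Finset.range (n + 1), G ((i + 1 : ℕ) : ℝ) := rfl
    have hG0 : G 0 ≤ 1 := hf.rpow_le_one hα _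
    have hGn : 0 ≤ G ((n + 1 : ℕ) : ℝ) := Real.rpow_nonneg (hf.nonneg _) _
    have hcc : c * (c⁻¹ * stringPos f α 1 t) = stringPos f α 1 t := by field_simp
    have e1 := mul_le_mul_of_nonneg_left h1 hc0.le
    have e2 := mul_le_mul_of_nonneg_left h2 hc0.le
    rw [hcc] at e1 e2
    refine ⟨hA ▸ e1, e2.trans ?_⟩
    rw [hA]
    -- Left and right sums of a monotone function differ by its end values only, here by at most
    -- `1`; after scaling, the error is at most `c = t / (n + 1)`.
    have hdiff : ∑ i ∈ Finset.range (n + 1), G (i : ℝ) =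
        ∑ i ∈ Finset.range (n + 1), G ((i + 1 : ℕ) : ℝ) + (G 0 - G ((n + 1 : ℕ) : ℝ)) := by
      have h := Finset.sum_range_succ (fun i : ℕ => G (i : ℝ)) (n + 1)
      have h' := Finset.sum_range_succ' (fun i : ℕ => G (i : ℝ)) (n + 1)
      simp only [Nat.cast_zero] at h'
      linarith
    rw [hdiff, mul_add]
    nlinarith
  have hz : Tendsto (fun n : ℕ => (t : ℝ) / (n + 1)) atTop (𝓝 0) := by
    have := tendsto_one_div_add_atTop_nhds_zero_nat.const_mul (t : ℝ)
    simpa [div_eq_mul_inv] using this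
  have hlow : Tendsto (fun n : ℕ => stringPos f α 1 t - t / (n + 1)) atTop
      (𝓝 (stringPos f α 1 t)) := by simpa using hz.const_sub (stringPos f α 1 t)
  exact tendsto_of_tendsto_of_tendsto_of_le_of_le hlow tendsto_const_nhds
    (fun n => by linarith [(hbound n).2]) fun n => (hbound n).1

/-- Measurable version of the position on the string of mass `1`. -/
noncomputable def posLimsup (α : ℝ) (f : ℝ≥0 → ℝ) (t : ℝ≥0) : ℝ :=
  limsup (posApprox α f t) atTop

lemma posLimsup_eq (hf : IsDecreasingPureJump f) (hα : 0 < α) (t : ℝ≥0) :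
    posLimsup α f t = stringPos f α 1 t :=
  (tendsto_posApprox hf hα t).limsup_eq

/-- Each Riemann sum reads finitely many coordinates of the path. This gives measurability on the
product space of all functions, where no path regularity is available. -/
lemma measurable_posLimsup (α : ℝ) (t : ℝ≥0) : Measurable fun f => posLimsup α f t := by
  refine Measurable.limsup fun n => ?_
  unfold posApprox
  fun_prop

end Strings

/-! ### Geometry of the trees -/

section Geometry

variable {α : ℝ} {f : ℕ → ℝ≥0 → ℝ} {J : ℕ → Pt}

/-- Points with nonnegative coordinates that vanish beyond the `n`th one. -/
def orthant (n : ℕ) : Set Pt := {x | (∀ i, 0 ≤ x i) ∧ ∀ i, n < i → x i = 0}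

lemma measurableSet_orthant (n : ℕ) : MeasurableSet (orthant n) := by
  have : orthant n = (⋂ i, {x : Pt | 0 ≤ x i}) ∩ ⋂ i, ⋂ (_ : n < i), {x : Pt | x i = 0} := by
    ext x; simp [orthant]
  rw [this]
  refine (MeasurableSet.iInter fun i => measurableSet_le measurable_const
    (measurable_pi_apply i)).inter (MeasurableSet.iInter fun i => MeasurableSet.iInter fun _ => ?_)
  exact measurableSet_eq_fun (measurable_pi_apply i) measurable_const

lemma orthant_mono : Monotone orthant := fun _ _ h _ hx =>
  ⟨hx.1, fun i hi => hx.2 i (h.trans_lt hi)⟩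

lemma measurable_extend (x : Pt) (k : ℕ) : Measurable (extend x k) := by
  refine measurable_pi_iff.2 fun i => ?_
  simp only [extend, Pi.add_apply, Pi.single_apply]
  by_cases h : i = k <;> simp only [h, if_true, if_false] <;> fun_prop

lemma extend_mem_orthant {x : Pt} {k : ℕ} (hx : x ∈ orthant k) {s : ℝ} (hs : 0 ≤ s) :
    extend x k s ∈ orthant k := by
  constructor
  · intro i
    by_cases h : i = k
    · subst h; simpa [extend] using add_nonneg (hx.1 i) hs
    · simpa [extend, h] using hx.1 i
  · intro i hi
    simp [extend, hi.ne', hx.2 i hi]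

lemma extend_apply_zero (x : Pt) {k : ℕ} (hk : k ≠ 0) (s : ℝ) : extend x k s 0 = x 0 := by
  simp [extend, hk.symm]

lemma stringMass_nonneg (n : ℕ) : 0 ≤ stringMass α f J n := by
  cases n
  · exact zero_le_one
  · exact ENNReal.toReal_nonneg

/-- The string attached at `J n` leaves in direction `n + 1 ≠ 0` and has exactly the mass of the
bead it replaces, so the image under coordinate `0` never changes. -/
lemma massMeasure_zero_coord (hα : 0 < α) (hf : ∀ n, IsDecreasingPureJump (f n))
    (hint : ∀ n, IntegrableOn (fun s : ℝ => f n s.toNNReal ^ α) (Set.Ioi 0)) (n : ℕ) {A : Set ℝ}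
    (hA : MeasurableSet A) :
    massMeasure α f J n ((fun x => x 0) ⁻¹' A) = stringMeasure (f 0) α 1 A := by
  have hev : Measurable fun x : Pt => x 0 := measurable_pi_apply 0
  induction n generalizing A with
  | zero =>
    rw [massMeasure, Measure.map_apply (measurable_extend 0 0) (hev hA)]
    congr 1
    ext s
    simp [extend]
  | succ n ih =>
    -- Finite total mass ensures that `toReal` in the definition of `massMeasure` loses nothing.
    have huniv : massMeasure α f J n Set.univ = 1 := by
      have := ih MeasurableSet.univ
      rw [stringMeasure_univ (hf 0) hα zero_le_one (hint 0), ENNReal.ofReal_one] at this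
      simpa using this
    have hfin : massMeasure α f J n {J n} ≠ ⊤ :=
      ((measure_mono (Set.subset_univ _)).trans_lt (huniv ▸ ENNReal.one_lt_top)).ne
    set S : Set Pt := (fun x => x 0) ⁻¹' A with hS
    have hSm : MeasurableSet S := hev hA
    have hJm : MeasurableSet ({J n} : Set Pt) := measurableSet_singleton _
    rw [massMeasure, Measure.add_apply, Measure.restrict_apply hSm,
      Measure.map_apply (measurable_extend _ _) hSm, ← ih hA, ← hS,
      ← measure_inter_add_sdiff S hJm, Set.sdiff_eq, add_comm]
    congr 1
    by_cases h : J n ∈ S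
    · have h1 : extend (J n) (n + 1) ⁻¹' S = Set.univ := by
        ext s
        simpa [hS, extend_apply_zero] using h
      rw [h1, stringMeasure_univ (hf _) hα ENNReal.toReal_nonneg (hint _),
        ENNReal.ofReal_toReal hfin, Set.inter_eq_right.2 (Set.singleton_subset_iff.2 h)]
    · have h1 : extend (J n) (n + 1) ⁻¹' S = ∅ := by
        ext s
        simpa [hS, extend_apply_zero] using h
      rw [h1, Set.inter_singleton_eq_empty.2 h]
      simp

lemma massMeasure_compl_orthant (hα : 0 < α) (hf : ∀ n, IsDecreasingPureJump (f n)) (n : ℕ)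
    (hJ : ∀ i < n, J i ∈ orthant i) : massMeasure α f J n (orthant n)ᶜ = 0 := by
  have hstring : ∀ {x : Pt} {k : ℕ} {m : ℝ}, x ∈ orthant k → 0 ≤ m →
      (stringMeasure (f k) α m).map (extend x k) (orthant k)ᶜ = 0 := by
    intro x k m hx hm
    rw [Measure.map_apply (measurable_extend _ _) (measurableSet_orthant _).compl]
    refine stringMeasure_eq_zero_of_forall hm
      (measurable_extend _ _ (measurableSet_orthant _).compl) fun t _ h => h ?_
    exact extend_mem_orthant hx (stringPos_nonneg (hf _) hα hm t)
  induction n with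
  | zero => exact hstring ⟨fun _ => le_rfl, fun _ _ => rfl⟩ zero_le_one
  | succ n ih =>
    rw [massMeasure, Measure.add_apply, hstring (orthant_mono n.le_succ (hJ n n.lt_succ_self))
      ENNReal.toReal_nonneg, add_zero]
    refine le_antisymm ((Measure.restrict_apply_le _ _).trans ?_) zero_le
    rw [← ih fun i hi => hJ i (hi.trans n.lt_succ_self)]
    exact measure_mono (Set.compl_subset_compl.2 (orthant_mono n.le_succ))

lemma summable_abs_sub {n : ℕ} {x y : Pt} (hx : x ∈ orthant n) (hy : y ∈ orthant n) :
    Summable fun i => |x i - y i| := by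
  refine summable_of_ne_finset_zero (s := Finset.range (n + 1)) fun i hi => ?_
  have hi : n < i := by simpa using hi
  simp [hx.2 i hi, hy.2 i hi]

lemma base_mem_orthant (hJ : ∀ n, J n ∈ orthant n) (n : ℕ) : base J n ∈ orthant n := by
  cases n with
  | zero => exact ⟨fun _ => le_rfl, fun _ _ => rfl⟩
  | succ n => exact orthant_mono n.le_succ (hJ n)

lemma branchLength_nonneg (hf : ∀ n, IsDecreasingPureJump (f n)) (n : ℕ) :
    0 ≤ branchLength α f J n :=
  stringLength_nonneg (hf n) (stringMass_nonneg n)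

lemma mem_fullTree {x : Pt} : x ∈ fullTree α f J ↔ ∃ n, x ∈ branch α f J n := by
  simp only [fullTree, tree, Set.mem_iUnion]
  exact ⟨fun ⟨_, k, _, h⟩ => ⟨k, h⟩, fun ⟨n, h⟩ => ⟨n, n, le_rfl, h⟩⟩

lemma exists_mem_orthant (hJ : ∀ n, J n ∈ orthant n) {x : Pt} (hx : x ∈ fullTree α f J) :
    ∃ n, x ∈ orthant n := by
  obtain ⟨n, s, hs, rfl⟩ := mem_fullTree.1 hx
  exact ⟨n, extend_mem_orthant (base_mem_orthant hJ n) hs.1⟩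

/-- The paths from the root are given by the coordinatewise order. -/
lemma mem_segment_zero (hJ : ∀ n, J n ∈ orthant n) {n : ℕ} {x : Pt} (hx : x ∈ orthant n)
    {z : Pt} : z ∈ segment α f J 0 x ↔ z ∈ fullTree α f J ∧ ∀ i, z i ≤ x i := by
  refine and_congr_right fun hz => ?_
  obtain ⟨k, hk⟩ := exists_mem_orthant hJ hz
  have hx' := orthant_mono (le_max_left n k) hx
  have hz' := orthant_mono (le_max_right n k) hk
  have h0 : (0 : Pt) ∈ orthant (max n k) := ⟨fun _ => le_rfl, fun _ _ => rfl⟩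
  have s1 := summable_abs_sub h0 hz'
  have s2 := summable_abs_sub hz' hx'
  have s3 := summable_abs_sub h0 hx'
  -- The slack in the triangle inequality is a sum of nonnegative coordinate terms. It vanishes
  -- exactly if each term does, which for nonnegative coordinates means `z i ≤ x i`.
  have hnn : ∀ i, 0 ≤ |(0 : Pt) i - z i| + |z i - x i| - |(0 : Pt) i - x i| := fun i => by
    linarith [abs_sub_le ((0 : Pt) i) (z i) (x i)]
  have key : treeDist 0 z + treeDist z x = treeDist 0 x ↔
      ∑' i, (|(0 : Pt) i - z i| + |z i - x i| - |(0 : Pt) i - x i|) = 0 := by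
    rw [(s1.add s2).tsum_sub s3, s1.tsum_add s2, sub_eq_zero]
    rfl
  rw [key, ← ((s1.add s2).sub s3).hasSum_iff, hasSum_zero_iff_of_nonneg hnn, funext_iff]
  refine forall_congr' fun i => ?_
  have hz0 := hz'.1 i
  have hx0 := hx'.1 i
  simp only [Pi.zero_apply, zero_sub, abs_neg, abs_of_nonneg hz0, abs_of_nonneg hx0]
  constructor
  · intro h
    by_contra hlt
    rw [abs_of_pos (by linarith)] at h
    linarith
  · intro h
    rw [abs_of_nonpos (by linarith)]
    ring

lemma treeDist_leaf_zero (hf : ∀ n, IsDecreasingPureJump (f n)) :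
    treeDist 0 (leaf α f J 0) = branchLength α f J 0 := by
  rw [treeDist, tsum_eq_single 0]
  · simp [leaf, base, extend, abs_of_nonneg (branchLength_nonneg hf 0)]
  · intro i hi
    simp [leaf, base, extend, hi]

/-- Leaf `k` branches off the spine at the position of its attachment point on the spine. -/
lemma spinalPartition_eq (hf : ∀ n, IsDecreasingPureJump (f n)) (hJ : ∀ n, J n ∈ orthant n)
    (hJ0 : ∀ n, J n 0 ≤ stringLength (f 0) α 1) :
    spinalPartition α f J = levelPartition fun k => J k 0 := by
  have hL : branchLength α f J 0 = stringLength (f 0) α 1 := rfl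
  have h0 : (0 : Pt) ∈ orthant 0 := ⟨fun _ => le_rfl, fun _ _ => rfl⟩
  have hspine : ∀ u ∈ Set.Icc 0 (branchLength α f J 0), extend 0 0 u ∈ fullTree α f J :=
    fun u hu => mem_fullTree.2 ⟨0, u, hu, rfl⟩
  have hleaf : ∀ k, leaf α f J k ∈ orthant k := fun k =>
    extend_mem_orthant (base_mem_orthant hJ k) (branchLength_nonneg hf k)
  ext s k
  simp only [spinalPartition, levelPartition, Set.mem_ofPred_eq, treeDist_leaf_zero hf]
  refine and_congr_right fun hk => ?_
  obtain ⟨k, rfl⟩ : ∃ j, k = j + 1 := ⟨k - 1, by omega⟩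
  have hlk : leaf α f J (k + 1) 0 = J k 0 := extend_apply_zero _ (by omega) _
  have hl0 : leaf α f J 0 0 = branchLength α f J 0 := by simp [leaf, base, extend]
  -- A spine point has only coordinate `0` nonzero, so its order relation to a point of the orthant
  -- is decided there.
  have hle : ∀ {u : ℝ} {x : Pt} {j : ℕ}, x ∈ orthant j →
      ((∀ i, extend 0 0 u i ≤ x i) ↔ u ≤ x 0) := by
    intro u x j hx
    constructor
    · intro h; simpa [extend] using h 0
    · intro h i
      by_cases hi : i = 0
      · subst hi; simpa [extend] using h
      · simpa [extend, hi] using hx.1 i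
  simp only [Nat.add_sub_cancel]
  constructor
  · rintro ⟨hs, -, hb⟩
    have hsm : extend 0 0 s ∈ orthant 0 := extend_mem_orthant h0 hs.1
    have hJk : J k 0 ∈ Set.Icc 0 (branchLength α f J 0) := ⟨(hJ k).1 0, hJ0 k⟩
    -- The two sides of the segment identity are tested on the spine points at heights `J k 0` and
    -- `s`.
    refine le_antisymm ?_ ?_
    · have : extend 0 0 (J k 0) ∈ segment α f J 0 (extend 0 0 s) := by
        rw [hb]
        refine ⟨(mem_segment_zero hJ (hleaf 0)).2 ⟨hspine _ hJk, (hle (hleaf 0)).2 ?_⟩,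
          (mem_segment_zero hJ (hleaf _)).2 ⟨hspine _ hJk, (hle (hleaf _)).2 hlk.ge⟩⟩
        exact hJk.2.trans hl0.ge
      have := ((mem_segment_zero hJ hsm).1 this).2 0
      simpa [extend] using this
    · have : extend 0 0 s ∈ segment α f J 0 (extend 0 0 s) :=
        (mem_segment_zero hJ hsm).2 ⟨hspine _ hs, fun _ => le_rfl⟩
      rw [hb] at this
      exact ((hle (hleaf _)).1 ((mem_segment_zero hJ (hleaf _)).1 this.2).2).trans hlk.le
  · rintro rfl
    have hJk : J k 0 ∈ Set.Icc 0 (branchLength α f J 0) := ⟨(hJ k).1 0, hJ0 k⟩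
    refine ⟨hJk, hspine _ hJk, ?_⟩
    ext z
    rw [Set.mem_inter_iff, mem_segment_zero hJ (extend_mem_orthant h0 hJk.1),
      mem_segment_zero hJ (hleaf 0), mem_segment_zero hJ (hleaf (k + 1)), ← and_and_left]
    refine and_congr_right fun hz => ?_
    obtain ⟨j, hj⟩ := exists_mem_orthant hJ hz
    constructor
    · intro h
      have hz0 : z 0 ≤ J k 0 := by simpa [extend] using h 0
      have hzi : ∀ i, i ≠ 0 → z i ≤ 0 := fun i hi => by simpa [extend, hi] using h i
      constructor
      · intro i
        by_cases hi : i = 0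
        · subst hi; rw [hl0]; exact hz0.trans hJk.2
        · exact (hzi i hi).trans ((hleaf 0).1 i)
      · intro i
        by_cases hi : i = 0
        · subst hi; rw [hlk]; exact hz0
        · exact (hzi i hi).trans ((hleaf _).1 i)
    -- Lying below `Σ_0` kills all coordinates but the first; lying below `Σ_{k+1}` bounds that one
    -- by `J k 0`.
    · rintro ⟨h1, h2⟩ i
      by_cases hi : i = 0
      · subst hi; simpa [extend, hlk] using h2 0
      · have := h1 i
        rw [(hleaf 0).2 i (Nat.pos_of_ne_zero hi)] at this
        simpa [extend, hi] using this

end Geometry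

/-! ### Branch positions are conditionally independent -/

lemma ext_of_pi_finset {μ ν : Measure (ℕ → ℝ)} [IsFiniteMeasure μ]
    (h : ∀ (F : Finset ℕ) (A : ℕ → Set ℝ), (∀ i, MeasurableSet (A i)) →
      μ ((F : Set ℕ).pi A) = ν ((F : Set ℕ).pi A)) : μ = ν := by
  refine ext_of_generate_finite _ generateFrom_squareCylinders.symm
    (isPiSystem_squareCylinders (fun _ => MeasurableSpace.isPiSystem_measurableSet) (by simp))
    ?_ ?_
  · rintro _ ⟨F, A, hA, rfl⟩
    exact h F A fun i => hA i (Set.mem_univ i)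
  · simpa using h ∅ (fun _ => Set.univ) fun _ => MeasurableSet.univ

section Law

set_option linter.unusedSectionVars false

variable {Ω : Type*} [MeasurableSpace Ω] {P : Measure Ω} [IsProbabilityMeasure P]
  {α : ℝ} {M : ℕ → ℝ≥0 → Ω → ℝ} {J : ℕ → Ω → Pt}

/-- The path of the process governing the spine. -/
def spinePath (M : ℕ → ℝ≥0 → Ω → ℝ) (ω : Ω) : ℝ≥0 → ℝ := fun t => M 0 t ω

/-- The position on the spine where leaf `n + 1` branches off. -/
def branchPos (J : ℕ → Ω → Pt) (ω : Ω) : ℕ → ℝ := fun n => J n ω 0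

/-- The conditional law of a branch position given the path governing the spine. -/
noncomputable def spineKernel (P : Measure Ω) [IsProbabilityMeasure P] (M : ℕ → ℝ≥0 → Ω → ℝ)
    (J : ℕ → Ω → Pt) : Kernel (ℝ≥0 → ℝ) ℝ :=
  condDistrib (fun ω => branchPos J ω 0) (spinePath M) P

instance : IsMarkovKernel (spineKernel P M J) := by unfold spineKernel; infer_instance

lemma measurable_spinePath_history (n : ℕ) : Measurable[history M J n] (spinePath M) := by
  refine (@measurable_pi_iff _ _ _ (history M J n) _ _).2 fun t => ?_
  refine Measurable.of_comap_le (le_trans ?_ le_sup_left)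
  exact le_iSup_of_le (0 : Fin (n + 1)) (le_iSup_of_le t le_rfl)

lemma measurable_branchPos_history {i n : ℕ} (h : i < n) :
    Measurable[history M J n] fun ω => branchPos J ω i := by
  have : Measurable[history M J n] (J i) := by
    refine Measurable.of_comap_le (le_trans ?_ le_sup_right)
    exact le_iSup_of_le (⟨i, h⟩ : Fin n) le_rfl
  exact (measurable_pi_apply 0).comp this

variable (hB : IsBeadSplittingProcess P α M J)
include hB

lemma IsBeadSplittingProcess.measurable_spinePath : Measurable (spinePath M) :=
  measurable_pi_iff.2 (hB.measurable_M 0)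

lemma IsBeadSplittingProcess.measurable_branchPos : Measurable (branchPos J) :=
  measurable_pi_iff.2 fun n => (measurable_pi_apply 0).comp (hB.measurable_J n)

/-- The sampling rule applied to cylinders over coordinate `0`: given the whole history, the law of
the next height depends on the spine path alone and not on `n`. -/
lemma IsBeadSplittingProcess.pick_spine (n : ℕ) {A : Set ℝ} (hA : MeasurableSet A) {B : Set Ω}
    (hBm : MeasurableSet[history M J n] B) :
    P (B ∩ {ω | branchPos J ω n ∈ A}) =
      ∫⁻ ω in B, stringMeasure (spinePath M ω) α 1 A ∂P := by
  have h := hB.pick n _ (measurable_pi_apply 0 hA) B hBm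
  rw [show {ω | branchPos J ω n ∈ A} = J n ⁻¹' ((fun x : Pt => x 0) ⁻¹' A) from rfl]
  refine h.trans (lintegral_congr_ae (ae_restrict_of_ae ?_))
  filter_upwards [ae_all_iff.2 hB.path, ae_all_iff.2 hB.integrable] with ω h1 h2
  exact massMeasure_zero_coord hB.alpha_pos h1 h2 n hA

/-- Turns the string measure, defined path by path, into a genuine Markov kernel. The conditional
law of the first height has the right tails at all rational levels almost surely, and these
determine a probability measure. -/
lemma IsBeadSplittingProcess.ae_spineKernel :
    ∀ᵐ ω ∂P, spineKernel P M J (spinePath M ω) = stringMeasure (spinePath M ω) α 1 := by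
  have hX := hB.measurable_spinePath
  -- The formula of `stringMeasure_Ioi` with `posLimsup` for `stringPos`, so that the tail is
  -- measurable in the path.
  set g : ℝ → (ℝ≥0 → ℝ) → ℝ≥0∞ := fun a f => ⨆ q : ℚ,
    if a < posLimsup α f (q : ℝ).toNNReal then ENNReal.ofReal (f (q : ℝ).toNNReal) else 0 with hg
  have hgm : ∀ a, Measurable (g a) := fun a => Measurable.iSup fun q =>
    Measurable.ite (measurableSet_lt measurable_const (measurable_posLimsup α _))
      (measurable_pi_apply _).ennreal_ofReal measurable_const
  have hgX : ∀ᵐ ω ∂P, ∀ a, stringMeasure (spinePath M ω) α 1 (Set.Ioi a) =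
      g a (spinePath M ω) := by
    filter_upwards [hB.path 0, hB.integrable 0] with ω h1 h2 a
    rw [stringMeasure_Ioi (f := spinePath M ω) h1 hB.alpha_pos h2]
    simp only [hg, posLimsup_eq (f := spinePath M ω) h1 hB.alpha_pos]
  have hκ : ∀ a, (fun f => spineKernel P M J f (Set.Ioi a)) =ᵐ[P.map (spinePath M)] g a := by
    intro a
    have : IsProbabilityMeasure (P.map (spinePath M)) :=
      Measure.isProbabilityMeasure_map hX.aemeasurable
    refine ae_eq_of_forall_setLIntegral_eq_of_sigmaFinite
      ((spineKernel P M J).measurable_coe measurableSet_Ioi) (hgm a) fun s hs _ => ?_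
    have hZ : Measurable fun ω => branchPos J ω 0 :=
      measurable_pi_iff.1 hB.measurable_branchPos 0
    have h1 := compProd_map_condDistrib (mβ := MeasurableSpace.pi) (μ := P)
      (X := spinePath M) hZ.aemeasurable
    have h2 : (P.map (spinePath M) ⊗ₘ spineKernel P M J) (s ×ˢ Set.Ioi a) =
        P (spinePath M ⁻¹' s ∩ {ω | branchPos J ω 0 ∈ Set.Ioi a}) := by
      rw [spineKernel, h1, Measure.map_apply (hX.prodMk hZ) (hs.prod measurableSet_Ioi)]
      rfl
    rw [← Measure.compProd_apply_prod hs measurableSet_Ioi, h2,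
      hB.pick_spine 0 measurableSet_Ioi (measurable_spinePath_history 0 hs),
      setLIntegral_map hs (hgm a) hX]
    refine lintegral_congr_ae (ae_restrict_of_ae ?_)
    filter_upwards [hgX] with ω h using h a
  have hκ' : ∀ᵐ ω ∂P, ∀ a : ℚ, spineKernel P M J (spinePath M ω) (Set.Ioi (a : ℝ)) =
      g a (spinePath M ω) :=
    ae_all_iff.2 fun a => ae_of_ae_map hX.aemeasurable (hκ a)
  filter_upwards [hκ', hgX, hB.path 0, hB.integrable 0] with ω h1 h2 h3 h4
  refine ext_of_generate_finite _ 
    (BorelSpace.measurable_eq.trans Real.borel_eq_generateFrom_Ioi_rat)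
    Real.isPiSystem_Ioi_rat ?_ ?_
  · simp only [Set.mem_iUnion, Set.mem_singleton_iff]
    rintro _ ⟨a, rfl⟩
    rw [h1, h2]
  · rw [measure_univ, stringMeasure_univ (f := spinePath M ω) h3 hB.alpha_pos zero_le_one h4,
      ENNReal.ofReal_one]

/-- One step of the conditional independence. -/
lemma IsBeadSplittingProcess.lintegral_step (n : ℕ)
    {G : (ℝ≥0 → ℝ) × (Fin n → ℝ) → ℝ≥0∞} (hG : Measurable G)
    {E : Set ((ℝ≥0 → ℝ) × ℝ)} (hE : MeasurableSet E) :
    ∫⁻ ω, G (spinePath M ω, fun i => branchPos J ω i) *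
        E.indicator 1 (spinePath M ω, branchPos J ω n) ∂P =
      ∫⁻ ω, G (spinePath M ω, fun i => branchPos J ω i) *
        spineKernel P M J (spinePath M ω) (Prod.mk (spinePath M ω) ⁻¹' E) ∂P := by
  have hX := hB.measurable_spinePath
  have hZ := hB.measurable_branchPos
  set Y : Ω → (ℝ≥0 → ℝ) × (Fin n → ℝ) := fun ω => (spinePath M ω, fun i => branchPos J ω i)
    with hYdef
  have hY : Measurable Y := by fun_prop
  have hYhist : Measurable[history M J n] Y :=
    (measurable_spinePath_history n).prodMk
      ((@measurable_pi_iff _ _ _ (history M J n) _ _).2 fun i =>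
        measurable_branchPos_history i.2)
  have hZn : Measurable fun ω => branchPos J ω n := by fun_prop
  -- This kernel ignores the earlier heights, which is the conditional independence.
  set κ : Kernel ((ℝ≥0 → ℝ) × (Fin n → ℝ)) ℝ := (spineKernel P M J).comap Prod.fst measurable_fst
    with hκ
  have : IsProbabilityMeasure (P.map Y) := Measure.isProbabilityMeasure_map hY.aemeasurable
  have : IsProbabilityMeasure (P.map fun ω => (Y ω, branchPos J ω n)) :=
    Measure.isProbabilityMeasure_map (hY.prodMk hZn).aemeasurable
  have hlaw : P.map (fun ω => (Y ω, branchPos J ω n)) = P.map Y ⊗ₘ κ := by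
    refine Measure.ext_prod fun {s t} hs ht => ?_
    rw [Measure.map_apply (hY.prodMk hZn) (hs.prod ht), Measure.compProd_apply_prod hs ht,
      setLIntegral_map hs (κ.measurable_coe ht) hY]
    refine (hB.pick_spine n ht (hYhist hs)).trans (lintegral_congr_ae (ae_restrict_of_ae ?_))
    filter_upwards [hB.ae_spineKernel] with ω h
    rw [hκ, Kernel.comap_apply, hYdef, h]
  have hE1 : Measurable (E.indicator (1 : (ℝ≥0 → ℝ) × ℝ → ℝ≥0∞)) :=
    measurable_one.indicator hE
  have hF : Measurable fun p : ((ℝ≥0 → ℝ) × (Fin n → ℝ)) × ℝ =>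
      G p.1 * E.indicator 1 (p.1.1, p.2) := by fun_prop
  have h1 := lintegral_map (μ := P) hF (hY.prodMk hZn)
  rw [hlaw, Measure.lintegral_compProd hF, lintegral_map hF.lintegral_kernel_prod_right' hY] at h1
  refine h1.symm.trans (lintegral_congr fun ω => ?_)
  have hE2 : Measurable fun b : ℝ => E.indicator (1 : (ℝ≥0 → ℝ) × ℝ → ℝ≥0∞) (spinePath M ω, b) :=
    hE1.comp measurable_prodMk_left
  change ∫⁻ b, G (Y ω) * E.indicator 1 (spinePath M ω, b) ∂(κ (Y ω)) = _
  rw [lintegral_const_mul _ hE2]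
  rw [hκ, Kernel.comap_apply]
  congr 1
  have hsec : MeasurableSet (Prod.mk (spinePath M ω) ⁻¹' E) := measurable_prodMk_left hE
  rw [← lintegral_indicator_one hsec]
  rfl

/-- Given the path governing the spine, the branch positions are independent and identically
distributed. -/
lemma IsBeadSplittingProcess.lintegral_prod_range (n : ℕ) {E : ℕ → Set ((ℝ≥0 → ℝ) × ℝ)}
    (hE : ∀ i, MeasurableSet (E i)) {g : (ℝ≥0 → ℝ) → ℝ≥0∞} (hg : Measurable g) :
    ∫⁻ ω, g (spinePath M ω) * ∏ i ∈ Finset.range n,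
        (E i).indicator 1 (spinePath M ω, branchPos J ω i) ∂P =
      ∫⁻ ω, g (spinePath M ω) * ∏ i ∈ Finset.range n,
        spineKernel P M J (spinePath M ω) (Prod.mk (spinePath M ω) ⁻¹' E i) ∂P := by
  have hind : ∀ i, Measurable ((E i).indicator (1 : (ℝ≥0 → ℝ) × ℝ → ℝ≥0∞)) :=
    fun i => measurable_one.indicator (hE i)
  induction n generalizing g with
  | zero => simp
  | succ n ih =>
    have hκ : Measurable fun f => spineKernel P M J f (Prod.mk f ⁻¹' E n) :=
      Kernel.measurable_kernel_prodMk_left (hE n)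
    have hstep := hB.lintegral_step n (G := fun p => g p.1 * ∏ i : Fin n,
      (E i).indicator 1 (p.1, p.2 i)) (by fun_prop) (hE n)
    simp only [Finset.prod_range_succ, ← mul_assoc]
    simp only [Finset.prod_range]
    rw [hstep]
    -- Once the last height is integrated out, its kernel factor is a function of the path and joins
    -- the weight `g`; hence the generality in `g`.
    have h2 := ih (hg.mul hκ)
    simp only [Finset.prod_range, Pi.mul_apply] at h2
    simp only [mul_right_comm _ (∏ i : Fin n, _)]
    exact h2

lemma IsBeadSplittingProcess.lintegral_prod (F : Finset ℕ) {E : ℕ → Set ((ℝ≥0 → ℝ) × ℝ)}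
    (hE : ∀ i, MeasurableSet (E i)) {g : (ℝ≥0 → ℝ) → ℝ≥0∞} (hg : Measurable g) :
    ∫⁻ ω, g (spinePath M ω) * ∏ i ∈ F,
        (E i).indicator 1 (spinePath M ω, branchPos J ω i) ∂P =
      ∫⁻ ω, g (spinePath M ω) * ∏ i ∈ F,
        spineKernel P M J (spinePath M ω) (Prod.mk (spinePath M ω) ⁻¹' E i) ∂P := by
  classical
  obtain ⟨n, hn⟩ := F.exists_nat_subset_range
  -- Indices outside `F` get the whole space, which contributes a factor `1` on both sides.
  have h := hB.lintegral_prod_range n (E := fun i => if i ∈ F then E i else Set.univ)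
    (fun i => by split_ifs; exacts [hE i, MeasurableSet.univ]) hg
  convert h using 4 with ω ω
  · rw [← Finset.prod_subset hn]
    · exact Finset.prod_congr rfl fun i hi => by simp [hi]
    · intro i _ hi
      simp [hi]
  · rw [← Finset.prod_subset hn]
    · exact Finset.prod_congr rfl fun i hi => by simp [hi]
    · intro i _ hi
      simp [hi]

/-- The sets `E i` may depend on the path, as is needed for grid cells, whose end positions are
random. -/
lemma IsBeadSplittingProcess.measure_forall_mem (F : Finset ℕ) {E : ℕ → Set ((ℝ≥0 → ℝ) × ℝ)}
    (hE : ∀ i, MeasurableSet (E i)) {B : Set (ℝ≥0 → ℝ)} (hBm : MeasurableSet B) :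
    P {ω | spinePath M ω ∈ B ∧ ∀ i ∈ F, (spinePath M ω, branchPos J ω i) ∈ E i} =
      ∫⁻ ω, B.indicator 1 (spinePath M ω) * ∏ i ∈ F,
        spineKernel P M J (spinePath M ω) (Prod.mk (spinePath M ω) ⁻¹' E i) ∂P := by
  have hX := hB.measurable_spinePath
  have hZ := hB.measurable_branchPos
  have hZi : ∀ i, Measurable fun ω => branchPos J ω i := fun i => by fun_prop
  have hS : MeasurableSet
      {ω | spinePath M ω ∈ B ∧ ∀ i ∈ F, (spinePath M ω, branchPos J ω i) ∈ E i} := by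
    refine (hX hBm).inter (s₂ := {ω | ∀ i ∈ F, (spinePath M ω, branchPos J ω i) ∈ E i}) ?_
    have : {ω | ∀ i ∈ F, (spinePath M ω, branchPos J ω i) ∈ E i} =
        ⋂ i ∈ F, {ω | (spinePath M ω, branchPos J ω i) ∈ E i} := by ext; simp
    exact this ▸ F.measurableSet_biInter fun i _ => (hX.prodMk (hZi i)) (hE i)
  rw [← hB.lintegral_prod F hE (measurable_one.indicator hBm), ← lintegral_indicator_one hS]
  refine lintegral_congr fun ω => ?_
  classical
  by_cases h1 : spinePath M ω ∈ B
  · by_cases h2 : ∀ i ∈ F, (spinePath M ω, branchPos J ω i) ∈ E i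
    · rw [Set.indicator_of_mem (show ω ∈ {ω | spinePath M ω ∈ B ∧
          ∀ i ∈ F, (spinePath M ω, branchPos J ω i) ∈ E i} from ⟨h1, h2⟩), Set.indicator_of_mem h1,
        Finset.prod_eq_one fun i hi => by rw [Set.indicator_of_mem (h2 i hi)]; rfl]
      simp
    · rw [Set.indicator_of_notMem fun h => h2 h.2]
      push Not at h2
      obtain ⟨i, hi, hi'⟩ := h2
      rw [Finset.prod_eq_zero hi (Set.indicator_of_notMem hi' _), mul_zero]
  · rw [Set.indicator_of_notMem fun h => h1 h.1, Set.indicator_of_notMem h1, zero_mul]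

/-- Exchangeability of the branch positions, jointly with the path governing the spine. -/
lemma IsBeadSplittingProcess.map_comp_injective {e : ℕ → ℕ} (he : Function.Injective e) :
    P.map (fun ω => (spinePath M ω, branchPos J ω ∘ e)) =
      P.map fun ω => (spinePath M ω, branchPos J ω) := by
  have hX := hB.measurable_spinePath
  have hZ := hB.measurable_branchPos
  have hZe : Measurable fun ω => branchPos J ω ∘ e :=
    measurable_pi_iff.2 fun i => (measurable_pi_apply (e i)).comp hZ
  have h1 : IsProbabilityMeasure (P.map fun ω => (spinePath M ω, branchPos J ω ∘ e)) :=
    Measure.isProbabilityMeasure_map (hX.prodMk hZe).aemeasurable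
  have h2 : IsProbabilityMeasure (P.map fun ω => (spinePath M ω, branchPos J ω)) :=
    Measure.isProbabilityMeasure_map (hX.prodMk hZ).aemeasurable
  refine Measure.ext_prod fun {B C} hBm hC => ?_
  rw [Measure.map_apply (hX.prodMk hZe) (hBm.prod hC), Measure.map_apply (hX.prodMk hZ)
    (hBm.prod hC)]
  have key : (P.restrict (spinePath M ⁻¹' B)).map (fun ω => branchPos J ω ∘ e) =
      (P.restrict (spinePath M ⁻¹' B)).map (branchPos J) := by
    refine ext_of_pi_finset fun F A hA => ?_
    have hpi : MeasurableSet ((F : Set ℕ).pi A) :=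
      MeasurableSet.pi F.countable_toSet fun i _ => hA i
    rw [Measure.map_apply hZe hpi, Measure.map_apply hZ hpi, Measure.restrict_apply (hZe hpi),
      Measure.restrict_apply (hZ hpi)]
    have e1 := hB.measure_forall_mem F (E := fun i => Prod.snd ⁻¹' A i)
      (fun i => measurable_snd (hA i)) hBm
    -- `Function.invFun e` inverts `e` on `F.image e` and so attaches `A i` to the index `e i`.
    have e2 := hB.measure_forall_mem (F.image e)
      (E := fun j => Prod.snd ⁻¹' A (Function.invFun e j))
      (fun i => measurable_snd (hA _)) hBm
    simp only [Finset.prod_image he.injOn, Function.leftInverse_invFun he _] at e2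
    rw [← e1] at e2
    convert e2 using 2
    · ext ω
      simp only [Set.mem_inter_iff, Set.mem_preimage, Set.mem_pi, Finset.mem_coe,
        Function.comp_apply, Finset.forall_mem_image, Function.leftInverse_invFun he _,
        Set.mem_ofPred_eq]
      exact and_comm
    · ext ω
      simp [and_comm]
  have := congrArg (fun μ => μ C) key
  simp only [Measure.map_apply hZe hC, Measure.map_apply hZ hC, Measure.restrict_apply (hZe hC),
    Measure.restrict_apply (hZ hC)] at this
  rw [Set.inter_comm, Set.inter_comm _ (spinePath M ⁻¹' B)] at this
  exact this

lemma IsBeadSplittingProcess.ae_forall_branchPos_notMem {E : Set ((ℝ≥0 → ℝ) × ℝ)}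
    (hE : MeasurableSet E)
    (h : ∀ᵐ ω ∂P, stringMeasure (spinePath M ω) α 1 (Prod.mk (spinePath M ω) ⁻¹' E) = 0) :
    ∀ᵐ ω ∂P, ∀ n, (spinePath M ω, branchPos J ω n) ∉ E := by
  refine ae_all_iff.2 fun n => ?_
  have h1 := hB.measure_forall_mem {n} (E := fun _ => E) (fun _ => hE) MeasurableSet.univ
  simp only [Set.mem_univ, Finset.mem_singleton, forall_eq, true_and, Set.indicator_univ,
    Pi.one_apply, Finset.prod_singleton, one_mul] at h1
  rw [ae_iff]
  simp only [not_not]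
  rw [h1, lintegral_eq_zero_iff' (Measurable.aemeasurable ?_)]
  · filter_upwards [h, hB.ae_spineKernel] with ω h2 h3
    rw [h3, h2]; rfl
  · exact (Kernel.measurable_kernel_prodMk_left hE).comp hB.measurable_spinePath

lemma IsBeadSplittingProcess.ae_branchPos_pos : ∀ᵐ ω ∂P, ∀ n, 0 < branchPos J ω n := by
  have := hB.ae_forall_branchPos_notMem (E := Prod.snd ⁻¹' Set.Iic 0)
    (measurable_snd measurableSet_Iic) (by
      filter_upwards [hB.path 0, hB.integrable 0] with ω h1 h2
      exact stringMeasure_Iic_zero h1 hB.alpha_pos one_pos h2)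
  filter_upwards [this] with ω h n
  simpa using h n

/-- Every bead sits at the position of a finite time. This keeps branch points on the spine and
makes grid cells well defined. -/
lemma IsBeadSplittingProcess.ae_branchPos_le :
    ∀ᵐ ω ∂P, ∀ n, ∃ k : ℕ, branchPos J ω n ≤ stringPos (spinePath M ω) α 1 k := by
  have hE : MeasurableSet {p : (ℝ≥0 → ℝ) × ℝ | ∀ k : ℕ, posLimsup α p.1 k < p.2} := by
    have : {p : (ℝ≥0 → ℝ) × ℝ | ∀ k : ℕ, posLimsup α p.1 k < p.2} =
      ⋂ k : ℕ, {p : (ℝ≥0 → ℝ) × ℝ | posLimsup α p.1 k < p.2} := by ext; simp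
    exact this ▸ MeasurableSet.iInter fun k =>
      measurableSet_lt ((measurable_posLimsup α k).comp measurable_fst) measurable_snd
  have := hB.ae_forall_branchPos_notMem hE (by
    filter_upwards [hB.path 0] with ω h1
    refine stringMeasure_eq_zero_of_forall zero_le_one (measurable_prodMk_left hE)
      fun t _ ht => ?_
    obtain ⟨k, hk⟩ := exists_nat_ge t
    have h2 := ht k
    simp only [posLimsup_eq (f := spinePath M ω) h1 hB.alpha_pos] at h2
    exact h2.not_ge (stringPos_mono h1 hB.alpha_pos zero_le_one hk))
  filter_upwards [this, hB.path 0] with ω h h1 n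
  have h := h n
  simp only [not_forall, not_lt,
    posLimsup_eq (f := spinePath M ω) h1 hB.alpha_pos] at h
  exact h

/-- Strong induction: if the earlier junction points lie in their orthants, `μ_n` does not charge
the complement of `orthant n`, and `J n` is sampled from `μ_n`. -/
lemma IsBeadSplittingProcess.ae_mem_orthant : ∀ᵐ ω ∂P, ∀ n, J n ω ∈ orthant n := by
  refine ae_all_iff.2 fun n => ?_
  induction n using Nat.strong_induction_on with
  | _ n ih =>
    have h := hB.pick n _ (measurableSet_orthant n).compl Set.univ MeasurableSet.univ
    rw [Set.univ_inter, Measure.restrict_univ] at h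
    have h0 : ∀ᵐ ω ∂P, massMeasure α (fun k t => M k t ω) (fun k => J k ω) n (orthant n)ᶜ = 0 := by
      have ih' : ∀ᵐ ω ∂P, ∀ i, i < n → J i ω ∈ orthant i :=
        ae_all_iff.2 fun i => by
          by_cases hi : i < n
          · filter_upwards [ih i hi] with ω h _ using h
          · exact ae_of_all _ fun ω h => absurd h hi
      filter_upwards [ae_all_iff.2 hB.path, ih'] with ω h1 h2
      exact massMeasure_compl_orthant hB.alpha_pos h1 n h2
    rw [lintegral_congr_ae h0, lintegral_zero] at h
    exact h

/-- Almost surely, the ordered spinal partition consists of the level sets of the branch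
positions. -/
lemma IsBeadSplittingProcess.ae_spinal_eq :
    ∀ᵐ ω ∂P, spinal α M J ω = levelPartition (branchPos J ω) := by
  filter_upwards [ae_all_iff.2 hB.path, hB.integrable 0, hB.ae_mem_orthant, hB.ae_branchPos_le]
    with ω h1 h2 h3 h4
  refine spinalPartition_eq h1 h3 fun n => ?_
  obtain ⟨k, hk⟩ := h4 n
  exact hk.trans (stringPos_le_stringLength (h1 0) zero_le_one h2 k)

end Law

/-! ### Exchangeability -/

/-- Labelling each occupied level by its least index turns the sum over real levels into a sum over
`ℕ`, which makes the point measure a measurable function of `z`. -/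
lemma bijective_firstIndex (z : ℕ → ℝ) : Function.Bijective
    fun k : {k : ℕ // ∀ j < k, z j ≠ z k} =>
      (⟨z k, k + 1, by simp [levelPartition]⟩ : {s : ℝ // (levelPartition z s).Nonempty}) := by
  constructor
  · rintro ⟨k, hk⟩ ⟨k', hk'⟩ h
    have h : z k = z k' := congrArg Subtype.val h
    rcases lt_trichotomy k k' with hlt | rfl | hlt
    · exact absurd h (hk' k hlt)
    · rfl
    · exact absurd h.symm (hk k' hlt)
  · rintro ⟨s, k, hk, rfl⟩
    classical
    have hex : ∃ j, z j = z (k - 1) := ⟨_, rfl⟩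
    refine ⟨⟨Nat.find hex, fun j hj => ?_⟩, Subtype.ext (Nat.find_spec hex)⟩
    rw [Nat.find_spec hex]
    exact Nat.find_min hex hj

lemma pointMeasure_levelPartition (z : ℕ → ℝ) {A : Set (ℝ × Set ℕ)} (hA : MeasurableSet A) :
    pointMeasure (levelPartition z) A = ∑' k, {k : ℕ | ∀ j < k, z j ≠ z k}.indicator
      (fun k => A.indicator 1 (z k, levelPartition z (z k))) k := by
  rw [pointMeasure, Measure.sum_apply _ hA, ← tsum_subtype,
    ← (Equiv.ofBijective _ (bijective_firstIndex z)).tsum_eq]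
  exact tsum_congr fun k => Measure.dirac_apply' _ hA

lemma measurableSet_coord_eq (i j : ℕ) : MeasurableSet {z : ℕ → ℝ | z i = z j} :=
  measurableSet_eq_fun (measurable_pi_apply i) (measurable_pi_apply j)

lemma measurable_pointMeasure_levelPartition :
    Measurable fun z : ℕ → ℝ => pointMeasure (levelPartition z) := by
  refine Measure.measurable_of_measurable_coe _ fun A hA => ?_
  simp only [pointMeasure_levelPartition _ hA]
  refine Measurable.tsum fun k => ?_
  have hpart : Measurable fun z : ℕ → ℝ => levelPartition z (z k) := by
    refine measurable_set_iff.2 fun j => measurableSet_setOfPred.1 ?_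
    have : {z : ℕ → ℝ | j ∈ levelPartition z (z k)} =
        {_z : ℕ → ℝ | 1 ≤ j} ∩ {z | z (j - 1) = z k} := rfl
    rw [this]
    exact (MeasurableSet.const _).inter (measurableSet_coord_eq _ _)
  have hset : MeasurableSet {z : ℕ → ℝ | ∀ j < k, z j ≠ z k} := by
    have : {z : ℕ → ℝ | ∀ j < k, z j ≠ z k} = ⋂ j, ⋂ (_ : j < k), {z | z j = z k}ᶜ := by
      ext; simp
    rw [this]
    exact MeasurableSet.iInter fun j => MeasurableSet.iInter fun _ => (measurableSet_coord_eq j k).compl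
  have hfun : Measurable fun z : ℕ → ℝ =>
      A.indicator (1 : ℝ × Set ℕ → ℝ≥0∞) (z k, levelPartition z (z k)) :=
    (measurable_one.indicator hA).comp ((measurable_pi_apply k).prodMk hpart)
  exact hfun.indicator hset

/-- Coordinate `k` belongs to leaf `k + 1`, so relabelling leaves by `σ` acts on the heights through
this shifted inverse. -/
lemma injective_shift_symm {σ : Equiv.Perm ℕ} (hσ : σ 0 = 0) :
    Function.Injective fun k => σ.symm (k + 1) - 1 := by
  have h0 : ∀ k, σ.symm (k + 1) ≠ 0 := fun k h => by
    have := (Equiv.symm_apply_eq σ).1 h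
    omega
  intro a b hab
  have ha := h0 a
  have hb := h0 b
  have : σ.symm (a + 1) = σ.symm (b + 1) := by simp only at hab; omega
  have := σ.symm.injective this
  omega

lemma image_levelPartition {σ : Equiv.Perm ℕ} (hσ : σ 0 = 0) (z : ℕ → ℝ) (s : ℝ) :
    σ '' levelPartition z s = levelPartition (z ∘ fun k => σ.symm (k + 1) - 1) s := by
  ext j
  rw [Equiv.image_eq_preimage_symm]
  have h0 : σ.symm 0 = 0 := (Equiv.symm_apply_eq σ).2 hσ.symm
  rcases j with - | j
  · simp [levelPartition, h0]
  · have : 1 ≤ σ.symm (j + 1) := by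
      by_contra h
      have := (Equiv.symm_apply_eq σ).1 (show σ.symm (j + 1) = 0 by omega)
      omega
    simp [levelPartition, this]

section Law

variable {Ω : Type*} [MeasurableSpace Ω] {P : Measure Ω} [IsProbabilityMeasure P]
  {α : ℝ} {M : ℕ → ℝ≥0 → Ω → ℝ} {J : ℕ → Ω → Pt} (hB : IsBeadSplittingProcess P α M J)
include hB

lemma IsBeadSplittingProcess.map_branchPos_comp {e : ℕ → ℕ} (he : Function.Injective e) :
    (P.map (branchPos J)).map (fun z => z ∘ e) = P.map (branchPos J) := by
  have hX := hB.measurable_spinePath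
  have hZ := hB.measurable_branchPos
  have hem : Measurable fun z : ℕ → ℝ => z ∘ e :=
    measurable_pi_iff.2 fun i => measurable_pi_apply (e i)
  have h1 : (P.map fun ω => (spinePath M ω, branchPos J ω ∘ e)).map Prod.snd =
      P.map ((fun z => z ∘ e) ∘ branchPos J) :=
    Measure.map_map measurable_snd (hX.prodMk (hem.comp hZ))
  have h2 : (P.map fun ω => (spinePath M ω, branchPos J ω)).map Prod.snd = P.map (branchPos J) :=
    Measure.map_map measurable_snd (hX.prodMk hZ)
  rw [Measure.map_map hem hZ, ← h1, hB.map_comp_injective he, h2]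

theorem IsBeadSplittingProcess.isOrderedPartition :
    IsOrderedPartition P (spinal α M J) := by
  filter_upwards [hB.ae_spinal_eq] with ω h
  rw [h]
  exact ⟨fun s h => absurd h.1 (by omega), fun k hk => ⟨branchPos J ω (k - 1), ⟨hk, rfl⟩,
    fun s hs => hs.2.symm⟩⟩

theorem IsBeadSplittingProcess.isExchangeable : IsExchangeable P (spinal α M J) := by
  intro σ hσ
  have hZ := hB.measurable_branchPos
  set e : ℕ → ℕ := fun k => σ.symm (k + 1) - 1 with he
  have hem : Measurable fun z : ℕ → ℝ => z ∘ e :=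
    measurable_pi_iff.2 fun i => measurable_pi_apply (e i)
  have hΦ := measurable_pointMeasure_levelPartition
  have h1 : (fun ω => pointMeasure fun s => σ '' spinal α M J ω s) =ᵐ[P]
      fun ω => pointMeasure (levelPartition (branchPos J ω ∘ e)) := by
    filter_upwards [hB.ae_spinal_eq] with ω h
    simp only [h, image_levelPartition hσ]
    rfl
  have h2 : (fun ω => pointMeasure (spinal α M J ω)) =ᵐ[P]
      fun ω => pointMeasure (levelPartition (branchPos J ω)) := by
    filter_upwards [hB.ae_spinal_eq] with ω h
    rw [h]
  have m1 : Measurable fun ω => pointMeasure (levelPartition (branchPos J ω ∘ e)) :=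
    hΦ.comp (hem.comp hZ)
  have m2 : Measurable fun ω => pointMeasure (levelPartition (branchPos J ω)) := hΦ.comp hZ
  refine ⟨m1.aemeasurable.congr h1.symm, m2.aemeasurable.congr h2.symm, ?_⟩
  rw [Measure.map_congr h1, Measure.map_congr h2]
  have h3 : P.map (fun ω => pointMeasure (levelPartition (branchPos J ω ∘ e))) =
      ((P.map (branchPos J)).map fun z => z ∘ e).map fun z => pointMeasure (levelPartition z) := by
    rw [Measure.map_map hem hZ, Measure.map_map hΦ (hem.comp hZ)]
    rfl
  rw [h3, hB.map_branchPos_comp (injective_shift_symm hσ), Measure.map_map hΦ hZ]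
  rfl

/-! ### Compositions read off from the branch positions -/

lemma IsBeadSplittingProcess.ae_blockSizes_eq : ∀ᵐ ω ∂P, ∀ n,
    blockSizes (spinal α M J ω) n = levelSizes (Finset.range n) (branchPos J ω) := by
  filter_upwards [hB.ae_spinal_eq] with ω h n
  rw [h, blockSizes_levelPartition]

lemma IsBeadSplittingProcess.measurableSet_levelSizes_branchPos (s : Finset ℕ) (l : List ℕ) :
    MeasurableSet {ω | levelSizes s (branchPos J ω) = l} :=
  hB.measurable_branchPos (measurableSet_levelSizes_eq s l)

theorem IsBeadSplittingProcess.isRandomComposition :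
    IsRandomComposition P fun n ω => blockSizes (spinal α M J ω) n := by
  refine fun n => ⟨?_, fun l => ?_⟩
  · filter_upwards [hB.ae_blockSizes_eq] with ω h
    rw [h]
    simpa using isComposition_levelSizes (Finset.range n) (branchPos J ω)
  · refine (hB.measurableSet_levelSizes_branchPos (Finset.range n) l).nullMeasurableSet.congr ?_
    refine Filter.eventuallyEq_set.2 ?_
    filter_upwards [hB.ae_blockSizes_eq] with ω h
    simp only [h]

end Law

/-! ### Strong sampling consistency -/

/-- `U j` is the event that removing index `j` gives `c n`. Swapping `j` and `n` preserves `{0, …, i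
- 1}` for every `i ≥ n + 1`, so all `U j` with `j ≤ n` have equal probability. Their sum counts, on
`V`, the balls whose removal gives `c n`. -/
lemma measure_levelSizes_erase {μ : Measure (ℕ → ℝ)} [IsProbabilityMeasure μ]
    (hμ : ∀ e : ℕ → ℕ, Function.Injective e → μ.map (fun z => z ∘ e) = μ) (n N : ℕ)
    (hN : n < N) (c : ℕ → List ℕ) :
    μ ({z | levelSizes (Finset.range n) z = c n} ∩
        {z | ∀ i ∈ Set.Icc (n + 1) N, levelSizes (Finset.range i) z = c i}) =
      removalProb (c (n + 1)) (c n) *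
        μ {z | ∀ i ∈ Set.Icc (n + 1) N, levelSizes (Finset.range i) z = c i} := by
  classical
  set V := {z : ℕ → ℝ | ∀ i ∈ Set.Icc (n + 1) N, levelSizes (Finset.range i) z = c i} with hV
  have hVm : MeasurableSet V := by
    have : V = ⋂ i ∈ Set.Icc (n + 1) N, {z | levelSizes (Finset.range i) z = c i} := by
      ext; simp [hV]
    exact this ▸ MeasurableSet.biInter (Set.to_countable _)
      fun i _ => measurableSet_levelSizes_eq _ _
  set U : ℕ → Set (ℕ → ℝ) := fun j =>
    {z | levelSizes ((Finset.range (n + 1)).erase j) z = c n} ∩ V with hU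
  have hUm : ∀ j, MeasurableSet (U j) := fun j => (measurableSet_levelSizes_eq _ _).inter hVm
  have hUn : {z : ℕ → ℝ | levelSizes (Finset.range n) z = c n} ∩ V = U n := by
    simp only [hU]
    rw [Finset.range_add_one, Finset.erase_insert Finset.notMem_range_self]
  have hswap : ∀ j ∈ Finset.range (n + 1), μ (U j) = μ (U n) := by
    intro j hj
    have hj : j < n + 1 := Finset.mem_range.1 hj
    have he := (Equiv.swap j n).injective
    have hem : Measurable fun z : ℕ → ℝ => z ∘ Equiv.swap j n :=
      measurable_pi_iff.2 fun i => measurable_pi_apply _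
    have hrange : ∀ i, n + 1 ≤ i → (Finset.range i).image (Equiv.swap j n) = Finset.range i := by
      intro i hi
      refine Finset.eq_of_subset_of_card_le (fun x hx => ?_)
        (Finset.card_image_of_injective _ he).ge
      obtain ⟨y, hy, rfl⟩ := Finset.mem_image.1 hx
      rw [Finset.mem_range] at hy ⊢
      rw [Equiv.swap_apply_def]
      split_ifs <;> omega
    have herase : ((Finset.range (n + 1)).erase n).image (Equiv.swap j n) =
        (Finset.range (n + 1)).erase j := by
      rw [Finset.image_erase he, hrange _ le_rfl, Equiv.swap_apply_right]
    have : U j = (fun z : ℕ → ℝ => z ∘ Equiv.swap j n) ⁻¹' U n := by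
      ext z
      simp only [hU, hV, Set.mem_inter_iff, Set.mem_ofPred_eq, Set.mem_preimage,
        ← levelSizes_image _ _ he, herase]
      refine and_congr_right fun _ => forall₂_congr fun i hi => ?_
      rw [hrange i hi.1]
    rw [this, ← Measure.map_apply hem (hUm n), hμ _ he]
  rw [hUn]
  -- A point of `V` is needed to know that `c (n + 1)` has sum `n + 1`; if there is none, both sides
  -- vanish.
  rcases V.eq_empty_or_nonempty with hemp | ⟨z₀, hz₀⟩
  · have : U n = ∅ := by rw [hU]; simp [hemp]
    rw [this, hemp]; simp
  have hmem : n + 1 ∈ Set.Icc (n + 1) N := ⟨le_rfl, hN⟩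
  have hsum : (c (n + 1)).sum = n + 1 := by
    rw [← hz₀ _ hmem, (isComposition_levelSizes _ _).2, Finset.card_range]
  set K : ℝ≥0∞ := ∑ b : Fin (c (n + 1)).length, ((c (n + 1)).get b : ℝ≥0∞) *
    (if removeBall (c (n + 1)) b = c n then 1 else 0) with hK
  have hsumU : ((n + 1 : ℕ) : ℝ≥0∞) * μ (U n) = K * μ V := by
    calc ((n + 1 : ℕ) : ℝ≥0∞) * μ (U n) = ∑ j ∈ Finset.range (n + 1), μ (U j) := by
          rw [Finset.sum_congr rfl hswap, Finset.sum_const, Finset.card_range, nsmul_eq_mul]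
      _ = ∫⁻ z, ∑ j ∈ Finset.range (n + 1), (U j).indicator 1 z ∂μ := by
          rw [lintegral_finsetSum _ fun j _ => measurable_one.indicator (hUm j)]
          exact Finset.sum_congr rfl fun j _ => (lintegral_indicator_one (hUm j)).symm
      _ = ∫⁻ z, V.indicator (fun _ => K) z ∂μ := by
          refine lintegral_congr fun z => ?_
          by_cases hz : z ∈ V
          · rw [Set.indicator_of_mem hz, hK]
            have hc := hz _ hmem
            have h := sum_levelSizes_erase (Finset.range (n + 1)) z
              fun l => if l = c n then (1 : ℝ≥0∞) else 0
            rw [hc] at h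
            rw [← h]
            refine Finset.sum_congr rfl fun j _ => ?_
            simp only [hU, Set.indicator, Set.mem_inter_iff, Set.mem_ofPred_eq, hz, and_true,
              Pi.one_apply]
          · rw [Set.indicator_of_notMem hz]
            exact Finset.sum_eq_zero fun j _ => Set.indicator_of_notMem (fun h => hz h.2) _
      _ = K * μ V := by rw [lintegral_indicator_const hVm]
  have hprob : removalProb (c (n + 1)) (c n) = K / ((n + 1 : ℕ) : ℝ≥0∞) := by
    rw [removalProb, hK, hsum, ENNReal.div_eq_inv_mul, Finset.mul_sum]
    refine Finset.sum_congr rfl fun b _ => ?_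
    split_ifs
    · rw [mul_one, ENNReal.div_eq_inv_mul]
    · simp
  rw [hprob, ← ENNReal.mul_div_right_comm, ← hsumU, mul_comm,
    ENNReal.mul_div_cancel_right (by simp) (by simp)]

theorem IsBeadSplittingProcess.stronglySamplingConsistent {Ω : Type*} [MeasurableSpace Ω]
    {P : Measure Ω} [IsProbabilityMeasure P] {α : ℝ} {M : ℕ → ℝ≥0 → Ω → ℝ} {J : ℕ → Ω → Pt}
    (hB : IsBeadSplittingProcess P α M J) :
    StronglySamplingConsistent P fun n ω => blockSizes (spinal α M J ω) n := by
  intro n N hnN c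
  have hZ := hB.measurable_branchPos
  have : IsProbabilityMeasure (P.map (branchPos J)) :=
    Measure.isProbabilityMeasure_map hZ.aemeasurable
  have hset : ∀ k, P {ω | ∀ i ∈ Set.Icc k N, blockSizes (spinal α M J ω) i = c i} =
      P.map (branchPos J) {z | ∀ i ∈ Set.Icc k N, levelSizes (Finset.range i) z = c i} := by
    intro k
    have hm : MeasurableSet
        {z : ℕ → ℝ | ∀ i ∈ Set.Icc k N, levelSizes (Finset.range i) z = c i} := by
      have : {z : ℕ → ℝ | ∀ i ∈ Set.Icc k N, levelSizes (Finset.range i) z = c i} =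
        ⋂ i ∈ Set.Icc k N, {z | levelSizes (Finset.range i) z = c i} := by ext; simp
      exact this ▸ MeasurableSet.biInter (Set.to_countable _)
        fun i _ => measurableSet_levelSizes_eq _ _
    rw [Measure.map_apply hZ hm]
    refine measure_congr (Filter.eventuallyEq_set.2 ?_)
    filter_upwards [hB.ae_blockSizes_eq] with ω h
    simp only [Set.mem_ofPred_eq, Set.mem_preimage, h]
  rw [hset, hset, ← measure_levelSizes_erase (fun e he => hB.map_branchPos_comp he) n N hnN]
  congr 1
  ext z
  have hIcc : Set.Icc n N = insert n (Set.Icc (n + 1) N) := by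
    ext i; simp only [Set.mem_Icc, Set.mem_insert_iff]; omega
  rw [hIcc]
  simp

/-! ### Discretised branch times -/

lemma measurable_sInf_nat {β : Type*} [MeasurableSpace β] {p : ℕ → Set β}
    (hp : ∀ k, MeasurableSet (p k)) : Measurable fun b => sInf {k | b ∈ p k} := by
  refine measurable_to_countable' fun k => ?_
  -- The second set accounts for `sInf ∅ = 0`.
  have : (fun b => sInf {k | b ∈ p k}) ⁻¹' {k} =
      (p k ∩ ⋂ j, ⋂ (_ : j < k), (p j)ᶜ) ∪ ({_b : β | k = 0} ∩ ⋂ j, (p j)ᶜ) := by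
    ext b
    simp only [Set.mem_preimage, Set.mem_singleton_iff, Set.mem_union, Set.mem_inter_iff,
      Set.mem_iInter, Set.mem_compl_iff, Set.mem_ofPred_eq]
    constructor
    · rintro rfl
      rcases {k | b ∈ p k}.eq_empty_or_nonempty with h | h
      · right
        refine ⟨by rw [h, Nat.sInf_empty], fun j hj => ?_⟩
        exact (Set.eq_empty_iff_forall_notMem.1 h) j hj
      · exact Or.inl ⟨Nat.sInf_mem h, fun j hj => Nat.notMem_of_lt_sInf hj⟩
    · rintro (⟨h1, h2⟩ | ⟨h1, h2⟩)
      · refine le_antisymm (Nat.sInf_le h1) (not_lt.1 fun h => ?_)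
        exact h2 _ h (Nat.sInf_mem (s := {k | b ∈ p k}) ⟨k, h1⟩)
      · have : {k | b ∈ p k} = ∅ := Set.eq_empty_iff_forall_notMem.2 h2
        rw [this, Nat.sInf_empty, h1]
  rw [this]
  exact ((hp k).inter (MeasurableSet.iInter fun j => MeasurableSet.iInter fun _ =>
    (hp j).compl)).union ((MeasurableSet.const _).inter (MeasurableSet.iInter fun j => (hp j).compl))

/-- The index `k` of the time interval `(k * h, (k + 1) * h]` that contains the time of the
position `v`. -/
noncomputable def gridCell (α : ℝ) (h : ℝ≥0) (f : ℝ≥0 → ℝ) (v : ℝ) : ℕ :=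
  sInf {k : ℕ | v ≤ posLimsup α f ((k + 1 : ℕ) * h)}

lemma measurable_gridCell (α : ℝ) (h : ℝ≥0) :
    Measurable fun p : (ℝ≥0 → ℝ) × ℝ => gridCell α h p.1 p.2 :=
  measurable_sInf_nat (p := fun k => {p : (ℝ≥0 → ℝ) × ℝ | p.2 ≤ posLimsup α p.1 ((k + 1 : ℕ) * h)})
    fun _ => measurableSet_le measurable_snd ((measurable_posLimsup α _).comp measurable_fst)

section Grid

variable {α : ℝ} {h : ℝ≥0} {f : ℝ≥0 → ℝ} {v : ℝ}

/-- Positivity of `v` gives the left bound in cell `0`, and `hex` excludes the default value of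
`sInf ∅`. -/
lemma gridCell_spec (hf : IsDecreasingPureJump f) (hα : 0 < α) (hh : 0 < h) (hv : 0 < v)
    (hex : ∃ k : ℕ, v ≤ stringPos f α 1 k) :
    stringPos f α 1 (gridCell α h f v * h) < v ∧
      v ≤ stringPos f α 1 ((gridCell α h f v + 1 : ℕ) * h) := by
  have hne : {k : ℕ | v ≤ posLimsup α f ((k + 1 : ℕ) * h)}.Nonempty := by
    obtain ⟨k, hk⟩ := hex
    obtain ⟨j, hj⟩ := exists_nat_ge ((k : ℝ≥0) / h)
    refine ⟨j, ?_⟩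
    rw [Set.mem_ofPred_eq, posLimsup_eq hf hα]
    refine hk.trans (stringPos_mono hf hα zero_le_one ?_)
    rw [div_le_iff₀ hh] at hj
    refine hj.trans ?_
    gcongr
    exact j.le_succ
  refine ⟨?_, posLimsup_eq hf hα _ ▸ Nat.sInf_mem hne⟩
  rcases Nat.eq_zero_or_pos (gridCell α h f v) with h0 | h0
  · rw [h0, Nat.cast_zero, zero_mul, stringPos_zero]
    exact hv
  · have hlt : gridCell α h f v - 1 < gridCell α h f v := by omega
    have := Nat.notMem_of_lt_sInf hlt
    rw [Set.mem_ofPred_eq, posLimsup_eq hf hα, Nat.sub_add_cancel h0] at this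
    exact not_le.1 this

lemma gridCell_eq_iff (hf : IsDecreasingPureJump f) (hα : 0 < α) (hh : 0 < h) (hv : 0 < v)
    (hex : ∃ k : ℕ, v ≤ stringPos f α 1 k) (k : ℕ) :
    gridCell α h f v = k ↔
      stringPos f α 1 (k * h) < v ∧ v ≤ stringPos f α 1 ((k + 1 : ℕ) * h) := by
  have hspec := gridCell_spec hf hα hh hv hex
  refine ⟨fun hk => hk ▸ hspec, fun hk => ?_⟩
  have hmono := stringPos_mono (m := 1) hf hα zero_le_one
  rcases lt_trichotomy (gridCell α h f v) k with hlt | heq | hlt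
  · have hle : ((gridCell α h f v + 1 : ℕ) : ℝ≥0) * h ≤ k * h := by gcongr; exact hlt
    exact absurd (hspec.2.trans (hmono hle)) hk.1.not_ge
  · exact heq
  · have hle : ((k + 1 : ℕ) : ℝ≥0) * h ≤ gridCell α h f v * h := by gcongr; exact hlt
    exact absurd (hk.2.trans (hmono hle)) hspec.1.not_ge

lemma gridCell_mono (hf : IsDecreasingPureJump f) (hα : 0 < α) {w : ℝ} (hvw : v ≤ w)
    (hex : ∃ k : ℕ, w ≤ stringPos f α 1 k) (hh : 0 < h) (hv : 0 < v) :
    gridCell α h f v ≤ gridCell α h f w := by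
  have h1 := gridCell_spec hf hα hh hv (hex.imp fun k hk => hvw.trans hk)
  have h2 := gridCell_spec hf hα hh (hv.trans_le hvw) hex
  by_contra hlt
  have hle : ((gridCell α h f w + 1 : ℕ) : ℝ≥0) * h ≤ gridCell α h f v * h := by
    gcongr; exact not_le.1 hlt
  have := stringPos_mono (m := 1) hf hα zero_le_one hle
  linarith [h1.1, h2.2]

/-- Since `f ≤ 1`, position grows at most at unit speed, so a time cell of length `h` covers at most
`h` in position. -/
lemma gridCell_lt (hf : IsDecreasingPureJump f) (hα : 0 < α) {w : ℝ} (hvw : v + h < w)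
    (hex : ∃ k : ℕ, w ≤ stringPos f α 1 k) (hh : 0 < h) (hv : 0 < v) :
    gridCell α h f v < gridCell α h f w := by
  have hvw' : v < w := lt_of_le_of_lt (le_add_of_nonneg_right h.coe_nonneg) hvw
  have h1 := gridCell_spec hf hα hh hv (hex.imp fun k hk => hvw'.le.trans hk)
  have h2 := gridCell_spec hf hα hh (hv.trans hvw') hex
  by_contra hle
  have hle : ((gridCell α h f w + 1 : ℕ) : ℝ≥0) * h ≤ (gridCell α h f v + 1 : ℕ) * h := by
    gcongr; exact not_lt.1 hle
  have h3 := stringPos_mono (m := 1) hf hα zero_le_one hle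
  have hle' : (gridCell α h f v : ℝ≥0) * h ≤ (gridCell α h f v + 1 : ℕ) * h := by
    gcongr; exact Nat.le_succ _
  have h4 := stringPos_sub_le hf hα hle'
  push_cast at h3 h4 h1 h2
  linarith [h1.1, h2.2]

/-- On fine grids the levels have the order of the cells. -/
lemma eventually_levelSizes_gridCell (hf : IsDecreasingPureJump f) (hα : 0 < α) {z : ℕ → ℝ}
    (hz : ∀ n, 0 < z n) (hex : ∀ n, ∃ k : ℕ, z n ≤ stringPos f α 1 k) (s : Finset ℕ) :
    ∀ᶠ N : ℕ in atTop, levelSizes s (fun i => gridCell α (1 / ((N : ℝ≥0) + 1)) f (z i)) =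
      levelSizes s z := by
  have hlim : Tendsto (fun N : ℕ => (1 : ℝ) / ((N : ℝ) + 1)) atTop (𝓝 0) :=
    tendsto_one_div_add_atTop_nhds_zero_nat
  have key : ∀ i ∈ s, ∀ j ∈ s, ∀ᶠ N : ℕ in atTop, z j < z i →
      gridCell α (1 / ((N : ℝ≥0) + 1)) f (z j) < gridCell α (1 / ((N : ℝ≥0) + 1)) f (z i) := by
    intro i _ j _
    by_cases hij : z j < z i
    · filter_upwards [hlim.eventually_lt_const (sub_pos.2 hij)] with N hN _
      refine gridCell_lt hf hα ?_ (hex i) (by positivity) (hz j)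
      push_cast
      linarith
    · exact Eventually.of_forall fun N h => absurd h hij
  have key' : ∀ᶠ N : ℕ in atTop, ∀ i ∈ s, ∀ j ∈ s, z j < z i →
      gridCell α (1 / ((N : ℝ≥0) + 1)) f (z j) < gridCell α (1 / ((N : ℝ≥0) + 1)) f (z i) := by
    rw [Finset.eventually_all]
    intro i hi
    rw [Finset.eventually_all]
    exact key i hi
  filter_upwards [key'] with N hN
  refine levelSizes_congr s fun i hi j hj => ⟨fun h => ?_, fun h => ?_⟩
  · by_contra hlt
    exact (hN i hi j hj (not_le.1 hlt)).not_ge h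
  · exact gridCell_mono hf hα h (hex j) (by positivity) (hz i)

end Grid

/-! ### Multiplicative random walks -/

section Walk

variable {Ω : Type*} [MeasurableSpace Ω] {P : Measure Ω}

lemma indepFun_shift {W : ℕ → Ω → ℝ} (hW : iIndepFun W P) (hm : ∀ i, Measurable (W i)) (K : ℕ) :
    IndepFun (fun ω (i : Fin K) => W i ω) (fun ω i => W (K + i) ω) P := by
  have hind := indep_iSup_of_disjoint (fun i => (hm i).comap_le) hW.iIndep
    (S := Set.Iio K) (T := Set.Ici K)
    (Set.disjoint_left.2 fun i hi hi' => (Set.mem_Iio.1 hi).not_ge hi')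
  refine (IndepFun_iff_Indep _ _ _).2 (indep_of_indep_of_le_left
    (indep_of_indep_of_le_right hind ?_) ?_)
  · refine Measurable.comap_le ((@measurable_pi_iff _ _ _ (_) _ _).2 fun i => ?_)
    exact Measurable.of_comap_le (le_iSup₂_of_le (K + i) (Nat.le_add_right K i) le_rfl)
  · refine Measurable.comap_le ((@measurable_pi_iff _ _ _ (_) _ _).2 fun i => ?_)
    exact Measurable.of_comap_le (le_iSup₂_of_le (i : ℕ) i.2 le_rfl)

/-- The jump from time `k` to time `k + 1` of the multiplicative random walk with steps
`exp (-w j)`. -/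
noncomputable def walkJump (w : ℕ → ℝ) (k : ℕ) : ℝ≥0∞ :=
  ENNReal.ofReal (Real.exp (-∑ j ∈ Finset.range k, w j) -
    Real.exp (-∑ j ∈ Finset.range (k + 1), w j))

lemma measurable_walkJump (k : ℕ) : Measurable fun w => walkJump w k := by
  unfold walkJump
  fun_prop

/-- From time `K` on, the walk is its value at `K` times the walk of the shifted steps. -/
lemma walkJump_add (w : ℕ → ℝ) (K j : ℕ) :
    walkJump w (K + j) = ENNReal.ofReal (Real.exp (-∑ i ∈ Finset.range K, w i)) *
      walkJump (fun i => w (K + i)) j := by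
  rw [walkJump, walkJump, ← ENNReal.ofReal_mul (Real.exp_nonneg _), mul_sub, ← Real.exp_add,
    ← Real.exp_add, Finset.sum_range_add, add_assoc, Finset.sum_range_add w K (j + 1)]
  congr 3 <;> ring

lemma prod_walkJump_add (w : ℕ → ℝ) (K : ℕ) (R : Finset ℕ) (y : ℕ → ℕ) :
    ∏ i ∈ R, walkJump w (K + y i) =
      ENNReal.ofReal (Real.exp (-∑ i ∈ Finset.range K, w i)) ^ R.card *
        ∏ i ∈ R, walkJump (fun i => w (K + i)) (y i) := by
  simp only [walkJump_add w K, Finset.prod_mul_distrib, Finset.prod_const]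

/-- The `k`th jump and the value at time `k + 1` depend on the first `k + 1` steps, which are
independent of the restarted walk. They form `c`, into which `R` enters only through the exponent
`r`. -/
lemma lintegral_walkJump {W : ℕ → Ω → ℝ} (hW : iIndepFun W P) (hm : ∀ i, Measurable (W i))
    (hid : ∀ i j, IdentDistrib (W i) (W j) P P) (k m r : ℕ) : ∃ c : ℝ≥0∞,
    ∀ (R : Finset ℕ), R.card = r → ∀ y : ℕ → ℕ,
      ∫⁻ ω, walkJump (fun i => W i ω) k ^ m * ∏ i ∈ R, walkJump (fun i => W i ω) (k + 1 + y i) ∂P =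
        c * ∫⁻ ω, ∏ i ∈ R, walkJump (fun i => W i ω) (y i) ∂P := by
  obtain ⟨φ, hφm, hφ⟩ : ∃ φ : (Fin (k + 1) → ℝ) → ℝ≥0∞, Measurable φ ∧ ∀ w : ℕ → ℝ,
      φ (fun i => w i) = walkJump w k ^ m *
        ENNReal.ofReal (Real.exp (-∑ i ∈ Finset.range (k + 1), w i)) ^ r := by
    refine ⟨fun v =>
      ENNReal.ofReal (Real.exp (-∑ i : Fin k, v i.castSucc) - Real.exp (-∑ i, v i)) ^ m *
        ENNReal.ofReal (Real.exp (-∑ i, v i)) ^ r, by fun_prop, fun w => ?_⟩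
    simp only [walkJump, Finset.sum_range, Fin.val_castSucc]
  refine ⟨∫⁻ ω, φ (fun i => W i ω) ∂P, fun R hR y => ?_⟩
  obtain ⟨ψ, hψm, hψ⟩ : ∃ ψ : (ℕ → ℝ) → ℝ≥0∞, Measurable ψ ∧
      ∀ w, ψ w = ∏ i ∈ R, walkJump w (y i) :=
    ⟨_, Finset.measurable_prod _ fun i _ => measurable_walkJump (y i), fun w => rfl⟩
  have hWm : Measurable fun ω i => W i ω := measurable_pi_iff.2 hm
  have hWm' : Measurable fun ω i => W (k + 1 + i) ω := measurable_pi_iff.2 fun i => hm _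
  have hid' : IdentDistrib (fun ω i => W (k + 1 + i) ω) (fun ω i => W i ω) P P :=
    IdentDistrib.pi (fun i => hid _ _)
      (hW.precomp (g := fun i => k + 1 + i) (add_right_injective _)) hW
  have hind : IndepFun (fun ω => φ (fun i => W i ω)) (fun ω => ψ fun i => W (k + 1 + i) ω) P :=
    (indepFun_shift hW hm (k + 1)).comp hφm hψm
  have hlaw : ∫⁻ ω, ψ (fun i => W (k + 1 + i) ω) ∂P = ∫⁻ ω, ψ (fun i => W i ω) ∂P := by
    rw [← lintegral_map hψm hWm', hid'.map_eq, lintegral_map hψm hWm]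
  have hφW : Measurable fun ω => φ fun i => W i ω := hφm.comp (measurable_pi_iff.2 fun i => hm _)
  have hψW : Measurable fun ω => ψ fun i => W (k + 1 + i) ω := hψm.comp hWm'
  simp only [← hψ]
  rw [← hlaw, ← lintegral_mul_eq_lintegral_mul_lintegral_of_indepFun'' hφW.aemeasurable
    hψW.aemeasurable hind]
  refine lintegral_congr fun ω => ?_
  rw [prod_walkJump_add, hψ, hR, hφ fun i => W i ω, mul_assoc]

end Walk

/-! ### Regeneration -/

section Regeneration

variable {Ω : Type*} [MeasurableSpace Ω] {P : Measure Ω}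
  {α : ℝ} {M : ℕ → ℝ≥0 → Ω → ℝ} {J : ℕ → Ω → Pt}

/-- Increments of a fragmenter along a grid come from a multiplicative random walk. -/
lemma IsFragmenter.exists_walk {X : ℝ≥0 → Ω → ℝ} (hX : IsFragmenter P X) (h : ℝ≥0) :
    ∃ W : ℕ → Ω → ℝ, iIndepFun W P ∧ (∀ i, Measurable (W i)) ∧
      (∀ i j, IdentDistrib (W i) (W j) P P) ∧ ∀ᵐ ω ∂P, ∀ k : ℕ,
        ENNReal.ofReal (X (k * h) ω - X ((k + 1 : ℕ) * h) ω) = walkJump (fun i => W i ω) k := by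
  obtain ⟨ξ, hξ, hXξ⟩ := hX
  set t : ℕ → ℝ≥0 := fun k => k * h with ht
  have htm : Monotone t := fun a b hab => by simp only [ht]; gcongr
  refine ⟨fun i ω => ξ (t (i + 1)) ω - ξ (t i) ω, hξ.indep.nat htm,
    fun i => (hξ.measurable _).sub (hξ.measurable _), ?_, ?_⟩
  · have key : ∀ i, IdentDistrib (fun ω => ξ (t (i + 1)) ω - ξ (t i) ω) (ξ h) P P := fun i => by
      have : t (i + 1) = t i + h := by simp only [ht]; push_cast; ring
      rw [this]
      exact hξ.stationary (t i) h
    exact fun i j => (key i).trans (key j).symm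
  · filter_upwards [hXξ, hξ.start] with ω h1 h2 k
    have hsum : ∀ k, ∑ j ∈ Finset.range k, (ξ (t (j + 1)) ω - ξ (t j) ω) = ξ (t k) ω := fun k => by
      rw [Finset.sum_range_sub (fun j => ξ (t j) ω)]
      simp [ht, h2]
    rw [walkJump, hsum, hsum, h1, h1]

/-- The indices of the grid cells of the branch times. -/
noncomputable def gridIndex (α : ℝ) (h : ℝ≥0) (M : ℕ → ℝ≥0 → Ω → ℝ) (J : ℕ → Ω → Pt) (ω : Ω) :
    ℕ → ℕ := fun i => gridCell α h (spinePath M ω) (branchPos J ω i)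

lemma measure_head_eq_tsum {D : Ω → List ℕ} (hD : ∀ l, MeasurableSet {ω | D ω = l}) (m : ℕ) :
    P {ω | (D ω).head? = some m} = ∑' l, P {ω | D ω = m :: l} := by
  have : {ω | (D ω).head? = some m} = ⋃ l, {ω | D ω = m :: l} := by
    ext ω
    simp only [Set.mem_ofPred_eq, Set.mem_iUnion]
    exact ⟨fun h => ⟨_, List.eq_cons_of_mem_head? h⟩, fun ⟨l, h⟩ => by rw [h]; rfl⟩
  rw [this, measure_iUnion _ fun l => hD _]
  intro l l' hne
  rw [Function.onFun, Set.disjoint_left]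
  intro ω h h'
  exact hne (List.cons.inj (h.symm.trans h')).2

variable [IsProbabilityMeasure P] (hB : IsBeadSplittingProcess P α M J)
include hB

lemma IsBeadSplittingProcess.measurable_gridIndex (h : ℝ≥0) : Measurable (gridIndex α h M J) :=
  measurable_pi_iff.2 fun i => (measurable_gridCell α h).comp
    (hB.measurable_spinePath.prodMk (measurable_pi_iff.1 hB.measurable_branchPos i))

/-- Cells are functions of path and height, so exchangeability jointly with the path is required. -/
lemma IsBeadSplittingProcess.map_gridIndex_comp (h : ℝ≥0) {e : ℕ → ℕ}
    (he : Function.Injective e) :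
    P.map (fun ω => gridIndex α h M J ω ∘ e) = P.map (gridIndex α h M J) := by
  have hX := hB.measurable_spinePath
  have hZ := hB.measurable_branchPos
  have hem : Measurable fun z : ℕ → ℝ => z ∘ e :=
    measurable_pi_iff.2 fun i => measurable_pi_apply (e i)
  have hΨ : Measurable fun p : (ℝ≥0 → ℝ) × (ℕ → ℝ) => fun i => gridCell α h p.1 (p.2 i) :=
    measurable_pi_iff.2 fun i => (measurable_gridCell α h).comp
      (measurable_fst.prodMk ((measurable_pi_apply i).comp measurable_snd))
  have h1 := Measure.map_map (μ := P) hΨ (hX.prodMk (hem.comp hZ))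
  have h2 := Measure.map_map (μ := P) hΨ (hX.prodMk hZ)
  have h3 := hB.map_comp_injective he
  exact h1.symm.trans ((congrArg _ h3).trans h2)

/-- Given the path, indices choose cells independently, and the mass of a cell is a difference of
two string tails. -/
lemma IsBeadSplittingProcess.measure_gridIndex_eq {h : ℝ≥0} (hh : 0 < h) (F : Finset ℕ)
    (y : ℕ → ℕ) : P {ω | ∀ i ∈ F, gridIndex α h M J ω i = y i} =
      ∫⁻ ω, ∏ i ∈ F, ENNReal.ofReal (M 0 (y i * h) ω - M 0 ((y i + 1 : ℕ) * h) ω) ∂P := by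
  set E : ℕ → Set ((ℝ≥0 → ℝ) × ℝ) := fun i =>
    {p | posLimsup α p.1 (y i * h) < p.2} ∩ {p | p.2 ≤ posLimsup α p.1 ((y i + 1 : ℕ) * h)}
    with hEdef
  have hpm : ∀ t, Measurable fun p : (ℝ≥0 → ℝ) × ℝ => posLimsup α p.1 t :=
    fun t => (measurable_posLimsup α t).comp measurable_fst
  have hE : ∀ i, MeasurableSet (E i) := fun i =>
    (measurableSet_lt (hpm _) measurable_snd).inter (measurableSet_le measurable_snd (hpm _))
  have hset : {ω | ∀ i ∈ F, gridIndex α h M J ω i = y i} =ᵐ[P]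
      {ω | spinePath M ω ∈ Set.univ ∧ ∀ i ∈ F, (spinePath M ω, branchPos J ω i) ∈ E i} := by
    refine Filter.eventuallyEq_set.2 ?_
    filter_upwards [hB.path 0, hB.ae_branchPos_pos, hB.ae_branchPos_le] with ω h1 h2 h3
    have h1 : IsDecreasingPureJump (spinePath M ω) := h1
    have heq : ∀ i, (spinePath M ω, branchPos J ω i) ∈ E i ↔ gridIndex α h M J ω i = y i := by
      intro i
      rw [gridIndex, gridCell_eq_iff h1 hB.alpha_pos hh (h2 i) (h3 i)]
      simp only [hEdef, Set.mem_inter_iff, Set.mem_ofPred_eq, posLimsup_eq h1 hB.alpha_pos]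
    simp only [Set.mem_univ, true_and, heq]
  rw [measure_congr hset, hB.measure_forall_mem F hE MeasurableSet.univ]
  refine lintegral_congr_ae ?_
  filter_upwards [hB.ae_spineKernel, hB.path 0, hB.integrable 0] with ω h1 h2 h3
  have h2 : IsDecreasingPureJump (spinePath M ω) := h2
  have h3 : IntegrableOn (fun s : ℝ => spinePath M ω s.toNNReal ^ α) (Set.Ioi 0) := h3
  rw [Set.indicator_univ, Pi.one_apply, one_mul]
  refine Finset.prod_congr rfl fun i _ => ?_
  have hle : ((y i : ℕ) : ℝ≥0) * h ≤ (y i + 1 : ℕ) * h := by gcongr; exact Nat.le_succ _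
  have hsec : Prod.mk (spinePath M ω) ⁻¹' E i =
      Set.Ioi (stringPos (spinePath M ω) α 1 (y i * h)) \
        Set.Ioi (stringPos (spinePath M ω) α 1 ((y i + 1 : ℕ) * h)) := by
    ext v
    simp [hEdef, posLimsup_eq h2 hB.alpha_pos]
  rw [h1, hsec, measure_sdiff (Set.Ioi_subset_Ioi (stringPos_mono h2 hB.alpha_pos zero_le_one hle))
    measurableSet_Ioi.nullMeasurableSet, stringMeasure_tail h2 hB.alpha_pos one_pos h3,
    stringMeasure_tail h2 hB.alpha_pos one_pos h3, one_mul, one_mul,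
    ← ENNReal.ofReal_sub _ (h2.nonneg _)]
  · rfl
  · rw [stringMeasure_tail h2 hB.alpha_pos one_pos h3]
    exact ENNReal.ofReal_ne_top

/-- Given that the branch times in `A` fall into the first occupied cell, the composition of the
others has its unconditional distribution. -/
lemma IsBeadSplittingProcess.measure_first_cell (hfrag : IsFragmenter P (M 0)) {h : ℝ≥0}
    (hh : 0 < h) (k m r : ℕ) : ∃ c : ℝ≥0∞, ∀ A R : Finset ℕ, A.card = m → R.card = r →
      Disjoint A R → ∀ l, P {ω | (∀ i ∈ A, gridIndex α h M J ω i = k) ∧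
        (∀ i ∈ R, k < gridIndex α h M J ω i) ∧ levelSizes R (gridIndex α h M J ω) = l} =
      c * P {ω | levelSizes R (gridIndex α h M J ω) = l} := by
  obtain ⟨W, hW, hWm, hWid, hMW⟩ := hfrag.exists_walk h
  obtain ⟨c, hc⟩ := lintegral_walkJump hW hWm hWid k m r
  refine ⟨c, fun A R hA hR hd l => ?_⟩
  set D := gridIndex α h M J with hDdef
  have hDi : ∀ i, Measurable fun ω => D ω i := measurable_pi_iff.1 (hB.measurable_gridIndex h)
  have hjoint : ∀ (F : Finset ℕ) (y : ℕ → ℕ), P {ω | ∀ i ∈ F, D ω i = y i} =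
      ∫⁻ ω, ∏ i ∈ F, walkJump (fun i => W i ω) (y i) ∂P := fun F y => by
    rw [hB.measure_gridIndex_eq hh]
    refine lintegral_congr_ae ?_
    filter_upwards [hMW] with ω hω
    exact Finset.prod_congr rfl fun i _ => hω (y i)
  set B : Set Ω := {ω | (∀ i ∈ A, D ω i = k) ∧ ∀ i ∈ R, k < D ω i} with hBdef
  have hsub : Measurable fun ω (i : R) => D ω i := measurable_pi_iff.2 fun i => hDi i
  have hshift : Measurable fun ω (i : R) => D ω i - (k + 1) :=
    measurable_pi_iff.2 fun i => (measurable_from_top (f := fun n : ℕ => n - (k + 1))).comp (hDi i)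
  -- On `B` all cells of `R` exceed `k`, so the truncated subtraction is harmless there and
  -- preserves order; equality is checked on singletons.
  have hlaw : (P.restrict B).map (fun ω (i : R) => D ω i - (k + 1)) =
      c • P.map fun ω (i : R) => D ω i := by
    refine Measure.ext_of_singleton fun y => ?_
    classical
    set y' : ℕ → ℕ := fun i => if hi : i ∈ R then y ⟨i, hi⟩ else 0 with hy'
    have hy'R : ∀ i : R, y' i = y i := fun i => by simp [hy']
    rw [Measure.smul_apply, Measure.map_apply hshift (measurableSet_singleton y),
      Measure.map_apply hsub (measurableSet_singleton y),
      Measure.restrict_apply (hshift (measurableSet_singleton y)), smul_eq_mul]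
    have h1 : (fun ω (i : R) => D ω i) ⁻¹' {y} = {ω | ∀ i ∈ R, D ω i = y' i} := by
      ext ω
      simp only [Set.mem_preimage, Set.mem_singleton_iff, funext_iff, Subtype.forall,
        Set.mem_ofPred_eq]
      exact forall₂_congr fun i hi => by rw [hy'R ⟨i, hi⟩]
    have h2 : (fun ω (i : R) => D ω i - (k + 1)) ⁻¹' {y} ∩ B =
        {ω | ∀ i ∈ A ∪ R, D ω i = if i ∈ A then k else k + 1 + y' i} := by
      ext ω
      simp only [Set.mem_inter_iff, Set.mem_preimage, Set.mem_singleton_iff, funext_iff,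
        Subtype.forall, hBdef, Set.mem_ofPred_eq, Finset.mem_union]
      constructor
      · rintro ⟨e1, e2, e3⟩ i (hi | hi)
        · rw [if_pos hi, e2 i hi]
        · rw [if_neg (Finset.disjoint_right.1 hd hi), hy'R ⟨i, hi⟩, ← e1 i hi]
          have := e3 i hi
          omega
      · intro e
        have eR : ∀ i (hi : i ∈ R), D ω i = k + 1 + y ⟨i, hi⟩ := fun i hi => by
          rw [e i (Or.inr hi), if_neg (Finset.disjoint_right.1 hd hi), hy'R ⟨i, hi⟩]
        refine ⟨fun i hi => ?_, fun i hi => ?_, fun i hi => ?_⟩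
        · rw [eR i hi]; omega
        · rw [e i (Or.inl hi), if_pos hi]
        · rw [eR i hi]; omega
    rw [h1, h2, hjoint, hjoint, ← hc R hR]
    refine lintegral_congr fun ω => ?_
    rw [Finset.prod_union hd]
    congr 1
    · rw [Finset.prod_congr rfl fun i hi => by rw [if_pos hi], Finset.prod_const, hA]
    · exact Finset.prod_congr rfl fun i hi => by rw [if_neg (Finset.disjoint_right.1 hd hi)]
  have huniv : ∀ z : ℕ → ℕ, levelSizes R z = levelSizes Finset.univ fun i : R => z i := fun z => by
    have := levelSizes_image (Finset.univ : Finset R) Subtype.val Subtype.val_injective z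
    rwa [Finset.univ_eq_attach, Finset.attach_image_val] at this
  have hlm : MeasurableSet {y : R → ℕ | levelSizes Finset.univ y = l} := Set.Countable.measurableSet
    (Set.to_countable _)
  have h3 := congrArg (fun μ => μ {y : R → ℕ | levelSizes Finset.univ y = l}) hlaw
  simp only [Measure.smul_apply, smul_eq_mul] at h3
  rw [Measure.map_apply hshift hlm, Measure.map_apply hsub hlm,
    Measure.restrict_apply (hshift hlm)] at h3
  convert h3 using 2
  · ext ω
    simp only [Set.mem_inter_iff, Set.mem_preimage, Set.mem_ofPred_eq, hBdef]
    rw [← and_assoc, and_comm]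
    refine and_congr_left fun ⟨_, e⟩ => ?_
    rw [huniv]
    have : levelSizes Finset.univ (fun i : R => D ω i) =
        levelSizes Finset.univ fun i : R => D ω i - (k + 1) := by
      refine levelSizes_congr _ fun i _ j _ => ?_
      have := e i i.2
      have := e j j.2
      omega
    rw [this]
  · congr 1
    ext ω
    simp only [Set.mem_preimage, Set.mem_ofPred_eq, huniv]

lemma IsBeadSplittingProcess.measure_levelSizes_gridIndex (h : ℝ≥0) (R : Finset ℕ) (l : List ℕ) :
    P {ω | levelSizes R (gridIndex α h M J ω) = l} =
      P {ω | levelSizes (Finset.range R.card) (gridIndex α h M J ω) = l} := by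
  obtain ⟨n, hn⟩ := R.exists_nat_subset_range
  -- Enumerates `R` and sends all further indices beyond `R`, to stay injective on `ℕ`.
  set e : ℕ → ℕ := fun i => if hi : i < R.card then R.orderEmbOfFin rfl ⟨i, hi⟩ else n + i with he
  have hmem : ∀ i (hi : i < R.card), R.orderEmbOfFin rfl ⟨i, hi⟩ < n := fun i hi =>
    Finset.mem_range.1 (hn (R.orderEmbOfFin_mem rfl _))
  have hinj : Function.Injective e := by
    intro i j hij
    simp only [he] at hij
    split_ifs at hij with h1 h2 h2
    · simpa using hij
    · have := hmem i h1; omega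
    · have := hmem j h2; omega
    · omega
  have himg : (Finset.range R.card).image e = R := by
    refine Finset.eq_of_subset_of_card_le (fun x hx => ?_)
      (by rw [Finset.card_image_of_injective _ hinj, Finset.card_range])
    obtain ⟨i, hi, rfl⟩ := Finset.mem_image.1 hx
    rw [Finset.mem_range] at hi
    simp only [he, dif_pos hi]
    exact R.orderEmbOfFin_mem rfl _
  have hD := hB.measurable_gridIndex h
  have hem : Measurable fun z : ℕ → ℕ => z ∘ e :=
    measurable_pi_iff.2 fun i => measurable_pi_apply (e i)
  have hlm : MeasurableSet {z : ℕ → ℕ | levelSizes (Finset.range R.card) z = l} :=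
    measurableSet_levelSizes_eq _ _
  have := congrArg (fun μ => μ {z : ℕ → ℕ | levelSizes (Finset.range R.card) z = l})
    (hB.map_gridIndex_comp h hinj)
  have hDe : Measurable fun ω => gridIndex α h M J ω ∘ e := hem.comp hD
  rw [Measure.map_apply hDe hlm, Measure.map_apply hD hlm] at this
  refine Eq.trans ?_ this
  congr 1
  ext ω
  simp only [Set.mem_preimage, Set.mem_ofPred_eq]
  rw [← levelSizes_image _ e hinj, himg]

lemma IsBeadSplittingProcess.measurableSet_levelSizes_gridIndex (h : ℝ≥0) (s : Finset ℕ)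
    (l : List ℕ) : MeasurableSet {ω | levelSizes s (gridIndex α h M J ω) = l} :=
  hB.measurable_gridIndex h (measurableSet_levelSizes_eq s l)

/-- The event splits according to the first occupied cell `k` and the set `A` of its occupants. The
constant of each piece depends on `k` alone, and by exchangeability the remaining indices may be
replaced by `{0, …, n - m - 1}`. -/
lemma IsBeadSplittingProcess.exists_measure_cons_gridIndex (hfrag : IsFragmenter P (M 0))
    {h : ℝ≥0} (hh : 0 < h) {n m : ℕ} (hm : 1 ≤ m) : ∃ c : ℝ≥0∞, ∀ l,
      P {ω | levelSizes (Finset.range n) (gridIndex α h M J ω) = m :: l} =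
        c * P {ω | levelSizes (Finset.range (n - m)) (gridIndex α h M J ω) = l} := by
  choose c hc using fun k => hB.measure_first_cell hfrag hh k m (n - m)
  set D := gridIndex α h M J with hD
  have hDi : ∀ i, Measurable fun ω => D ω i := measurable_pi_iff.1 (hB.measurable_gridIndex h)
  refine ⟨∑' p : (Finset.range n).powersetCard m × ℕ, c p.2, fun l => ?_⟩
  set S : (Finset.range n).powersetCard m × ℕ → Set Ω := fun p =>
    {ω | (∀ i ∈ p.1.1, D ω i = p.2) ∧ (∀ i ∈ Finset.range n \ p.1.1, p.2 < D ω i) ∧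
      levelSizes (Finset.range n \ p.1.1) (D ω) = l} with hS
  have hunion : {ω | levelSizes (Finset.range n) (D ω) = m :: l} = ⋃ p, S p := by
    ext ω
    simp only [Set.mem_ofPred_eq, levelSizes_eq_cons_iff, Set.mem_iUnion, hS, Prod.exists,
      Subtype.exists]
    constructor
    · rintro ⟨A, hA, -, v, h1, h2, h3⟩
      exact ⟨A, hA, v, h1, h2, h3⟩
    · rintro ⟨A, hA, v, h1, h2, h3⟩
      refine ⟨A, hA, Finset.card_pos.1 ?_, v, h1, h2, h3⟩
      rw [(Finset.mem_powersetCard.1 hA).2]; omega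
  have hdisj : Pairwise (Function.onFun Disjoint S) := by
    rintro ⟨⟨A, hA⟩, k⟩ ⟨⟨A', hA'⟩, k'⟩ hne
    rw [Function.onFun, Set.disjoint_left]
    rintro ω ⟨h1, h2, -⟩ ⟨h1', h2', -⟩
    simp only at h1 h2 h1' h2'
    rw [Finset.mem_powersetCard] at hA hA'
    -- `k'` is a lower bound for all cells, and `k` is attained because `m ≥ 1` makes `A` nonempty.
    have hle : ∀ {A A' : Finset ℕ} {k k' : ℕ}, A ⊆ Finset.range n → A.card = m →
        (∀ i ∈ A, D ω i = k) → (∀ i ∈ A', D ω i = k') →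
        (∀ i ∈ Finset.range n \ A', k' < D ω i) → k' ≤ k := by
      intro A A' k k' hA hAm e1 e1' e2'
      obtain ⟨a, ha⟩ := Finset.card_pos.1 (by omega : 0 < A.card)
      rw [← e1 a ha]
      by_cases haA : a ∈ A'
      · exact (e1' a haA).ge
      · exact (e2' a (Finset.mem_sdiff.2 ⟨hA ha, haA⟩)).le
    have hkk : k = k' := le_antisymm (hle hA'.1 hA'.2 h1' h1 h2) (hle hA.1 hA.2 h1 h1' h2')
    subst hkk
    have hAA : A = A' := by
      refine Finset.eq_of_subset_of_card_le (fun a ha => ?_) (by rw [hA.2, hA'.2])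
      by_contra haA
      exact (h2' a (Finset.mem_sdiff.2 ⟨hA.1 ha, haA⟩)).ne' (h1 a ha)
    subst hAA
    exact hne rfl
  have hmeas : ∀ p, MeasurableSet (S p) := by
    intro p
    have : S p = (⋂ i ∈ p.1.1, {ω | D ω i = p.2}) ∩
        ((⋂ i ∈ Finset.range n \ p.1.1, {ω | p.2 < D ω i}) ∩
          {ω | levelSizes (Finset.range n \ p.1.1) (D ω) = l}) := by
      ext ω; simp [hS]
    rw [this]
    exact (Finset.measurableSet_biInter _ fun i _ =>
      measurableSet_eq_fun (hDi i) measurable_const).inter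
      ((Finset.measurableSet_biInter _ fun i _ => measurableSet_lt measurable_const (hDi i)).inter
        (hB.measurableSet_levelSizes_gridIndex h _ _))
  rw [hunion, measure_iUnion hdisj hmeas, ← ENNReal.tsum_mul_right]
  refine tsum_congr fun p => ?_
  have hp := Finset.mem_powersetCard.1 p.1.2
  have hcard : (Finset.range n \ p.1.1).card = n - m := by
    rw [Finset.card_sdiff_of_subset hp.1, Finset.card_range, hp.2]
  rw [hc p.2 p.1.1 _ hp.2 hcard Finset.disjoint_sdiff l, hB.measure_levelSizes_gridIndex h, hcard]

/-- Summing over `l` identifies the constant: the left sides add up to the probability of first part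
`m`, the right ones to `c`. -/
lemma IsBeadSplittingProcess.measure_cons_gridIndex (hfrag : IsFragmenter P (M 0))
    {h : ℝ≥0} (hh : 0 < h) {n m : ℕ} (hm : 1 ≤ m) (l : List ℕ) :
      P {ω | levelSizes (Finset.range n) (gridIndex α h M J ω) = m :: l} =
        P {ω | (levelSizes (Finset.range n) (gridIndex α h M J ω)).head? = some m} *
          P {ω | levelSizes (Finset.range (n - m)) (gridIndex α h M J ω) = l} := by
  obtain ⟨c, hc⟩ := hB.exists_measure_cons_gridIndex hfrag hh (n := n) hm
  have hm' := fun s => hB.measurableSet_levelSizes_gridIndex h s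
  have htot : ∑' l, P {ω | levelSizes (Finset.range (n - m)) (gridIndex α h M J ω) = l} = 1 := by
    rw [← measure_iUnion _ fun l => hm' _ l]
    · rw [← measure_univ (μ := P)]
      congr 1
      ext ω; simp
    · intro l l' hne
      rw [Function.onFun, Set.disjoint_left]
      intro ω h h'
      exact hne (h.symm.trans h')
  rw [measure_head_eq_tsum (hm' _)]
  simp only [hc]
  rw [ENNReal.tsum_mul_left, htot, mul_one]

theorem IsBeadSplittingProcess.regenerative (hfrag : IsFragmenter P (M 0)) :
    Regenerative P fun n ω => blockSizes (spinal α M J ω) n := by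
  intro n m hm hmn l
  have hcongr : ∀ (k : ℕ) (p : List ℕ → Prop), P {ω | p (blockSizes (spinal α M J ω) k)} =
      P {ω | p (levelSizes (Finset.range k) (branchPos J ω))} := by
    intro k p
    refine measure_congr (Filter.eventuallyEq_set.2 ?_)
    filter_upwards [hB.ae_blockSizes_eq] with ω h
    simp only [h]
  rw [hcongr n (· = m :: l), hcongr n (fun c => c.head? = some m), hcongr (n - m) (· = l)]
  have hmeas : ∀ {D : Ω → List ℕ}, (∀ l, MeasurableSet {ω | D ω = l}) →
      ∀ p : List ℕ → Prop, MeasurableSet {ω | p (D ω)} := by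
    intro D hD p
    have : {ω | p (D ω)} = ⋃ l ∈ {l | p l}, {ω | D ω = l} := by ext; simp
    exact this ▸ MeasurableSet.biUnion (Set.to_countable _) fun l _ => hD l
  set h : ℕ → ℝ≥0 := fun N => 1 / ((N : ℝ≥0) + 1) with hh
  -- Almost surely the grid composition equals the true one for all fine grids, so indicators and
  -- hence probabilities converge.
  have hlim : ∀ (k : ℕ) (p : List ℕ → Prop),
      Tendsto (fun N => P {ω | p (levelSizes (Finset.range k) (gridIndex α (h N) M J ω))}) atTop
        (𝓝 (P {ω | p (levelSizes (Finset.range k) (branchPos J ω))})) := by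
    intro k p
    refine tendsto_measure_of_ae_tendsto_indicator_of_isFiniteMeasure atTop
      (hmeas (fun l => hB.measurableSet_levelSizes_branchPos _ l) p)
      (fun N => hmeas (fun l => hB.measurableSet_levelSizes_gridIndex _ _ l) p) ?_
    filter_upwards [hB.path 0, hB.ae_branchPos_pos, hB.ae_branchPos_le] with ω h1 h2 h3
    filter_upwards [eventually_levelSizes_gridCell (f := spinePath M ω) h1 hB.alpha_pos h2 h3
      (Finset.range k)] with N hN
    exact iff_of_eq (congrArg p hN)
  refine tendsto_nhds_unique (hlim n (· = m :: l)) ?_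
  refine Tendsto.congr (fun N => (hB.measure_cons_gridIndex hfrag (h := h N)
    (by positivity) hm l).symm) ?_
  exact ENNReal.Tendsto.mul (hlim n fun c => c.head? = some m)
    (Or.inr (measure_ne_top _ _)) (hlim (n - m) (· = l)) (Or.inr (measure_ne_top _ _))

end Regeneration

end BeadSplitting

theorem mainTheorem11 {Ω : Type*} [MeasurableSpace Ω] (P : Measure Ω) [IsProbabilityMeasure P]
    (α : ℝ) (M : ℕ → ℝ≥0 → Ω → ℝ) (J : ℕ → Ω → BeadSplitting.Pt)
    (hB : BeadSplitting.IsBeadSplittingProcess P α M J) :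
    (BeadSplitting.IsOrderedPartition P (BeadSplitting.spinal α M J) ∧
      BeadSplitting.IsExchangeable P (BeadSplitting.spinal α M J)) ∧
    (BeadSplitting.IsFragmenter P (M 0) →
      BeadSplitting.IsRandomComposition P
        (fun n ω => BeadSplitting.blockSizes (BeadSplitting.spinal α M J ω) n) ∧
      BeadSplitting.StronglySamplingConsistent P
        (fun n ω => BeadSplitting.blockSizes (BeadSplitting.spinal α M J ω) n) ∧
      BeadSplitting.Regenerative P
        (fun n ω => BeadSplitting.blockSizes (BeadSplitting.spinal α M J ω) n)) := by
  exact ⟨⟨hB.isOrderedPartition, hB.isExchangeable⟩, fun hfrag =>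
    ⟨hB.isRandomComposition, hB.stronglySamplingConsistent, hB.regenerative hfrag⟩⟩
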